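/- **Setting.** Consider a soft arm modelled as a Cosserat rod with piecewise constant strain (PCS): nodes $0=L_0<L_1<\dots<L_N$, joint vector $q=(\xi_1,\dots,\xi_N)\in\mathbb R^{6N}$, where $\xi_n\in\mathbb R^6$ (angular part first) is the constant strain on section $n$. The pose relative to the base is $g(X)\in SE(3)$ with $g(0)=I$ and $g^{-1}\partial_X g=\hat\xi_n$ on section $n$. The Jacobian $J(X)=J(X,q)$ is defined by $(g^{-1}\partial_t g)^\vee=J\dot q$. Write $\mathrm{Ad}$, $\mathrm{ad}$ for the adjoint representations and $\mathrm{ad}^\star_\eta=-\mathrm{ad}_\eta^\top$. Let $\mathcal M=\rho\,\mathrm{diag}(I_x,I_y,I_z,A,A,A)$ with density $\rho>0$ and positive integrable functions $I_x,I_y,I_z,A$ of $X\in[0,L_N]$; let $\mathcal M_a=\mathcal M+\mathcal M_f$ with an integrable, symmetric positive semidefinite added-mass matrix $\mathcal M_f(X)$; let $\mathcal D(X)$ be an integrable drag matrix with $w^\top\mathcal D(X)w\ge0$ for all $w\in\mathbb R^6$; let $\rho_f\ge0$ be the density of the fluid, $\mathcal G=(0,0,0,-g_0,0,0)^\top$ the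 gravitational vector ($g_0$ the gravitational acceleration), and $g_r$ the constant transformation between the inertial and the base frame, namely the rotation matrix with rows $(0,-1,0),(1,0,0),(0,0,1)$ and no translation. With $\|\cdot\|_p$ the Euclidean norm of the translational part of a twist, put $$M(q)=\int_0^{L_N}J^\top\mathcal M_aJ\,dX,\quad C_1(q,\dot q)=\int_0^{L_N}J^\top\mathrm{ad}^\star_{J\dot q}\mathcal M_aJ\,dX,\quad C_2(q,\dot q)=\int_0^{L_N}J^\top\mathcal M_a\dot J\,dX,$$ $$D(q,\dot q)=\int_0^{L_N}J^\top\mathcal DJ\,\|J\dot q\|_p\,dX,\quad N(q)=\Bigl(1-\frac{\rho_f}{\rho}\Bigr)\int_0^{L_N}J^\top\mathcal M\,\mathrm{Ad}_{g}^{-1}\,dX .$$ Let $F(q)=J(\bar X)^\top\mathcal F_p$ be the generalized force of the wrench $\mathcal F_p$ that a cable applies at $\bar X\in[0,L_N]$; if there is no cable, this force is absent. With the generalized torque $u$ as control input, the PCS system is $$M(q)\ddot q+[C_1(q,\dot q)+C_2(q,\dot q)]\dot q=u+F(q)+N(q)\mathrm{Ad}_{g_r}^{-1}\mathcal G-D(q,\dot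 q)\dot q .$$ **Statement.** Suppose that the robot is operated without cables (fluid-driven actuation) and that gravity and buoyancy exert no net generalized force, $N(q)\mathrm{Ad}_{g_r}^{-1}\mathcal G=0$ for all $q$ (for example because $g_0=0$ or $\rho_f=\rho$). Then $F(q)=0$ for all $q$. Moreover, let $K_p,K_D$ be symmetric positive definite matrices (for instance diagonal with positive entries), let $q^d\in\mathbb R^{6N}$, and put $\tilde q=q-q^d$. Then the plain PD law $$u(q,\dot q)=-K_p\tilde q-K_D\dot q$$ globally asymptotically stabilizes the PCS system at $(q,\dot q)=(q^d,0)$. That is: $(q^d,0)$ is an equilibrium of the closed loop; from every initial state the closed loop has a unique solution, which exists for all $t\ge0$; the equilibrium is Lyapunov stable; and every solution satisfies $(q(t),\dot q(t))\to(q^d,0)$ as $t\to\infty$. -/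

import Mathlib

open scoped Matrix

noncomputable section

namespace PCS

/-! ### Rigid-body kinematics on the special Euclidean group -/

/-- Twists, strains and wrenches in coordinates: angular part first (indices `0, 1, 2`),
linear part second (indices `3, 4, 5`). -/
abbrev Vec6 : Type := Fin 6 → ℝ

/-- The isomorphism from `ℝ⁶` to the Lie algebra `𝔰𝔢(3)`, as `4 × 4` matrices. -/
def hat (x : Vec6) : Matrix (Fin 4) (Fin 4) ℝ :=
  !![0, -x 2, x 1, x 3;
     x 2, 0, -x 0, x 4;
     -x 1, x 0, 0, x 5;
     0, 0, 0, 0]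

/-- The inverse of `hat` on `𝔰𝔢(3)`. -/
def vee (A : Matrix (Fin 4) (Fin 4) ℝ) : Vec6 :=
  ![A 2 1, A 0 2, A 1 0, A 0 3, A 1 3, A 2 3]

/-- The adjoint representation of `SE(3)`: `Ad_g x = (g x̂ g⁻¹)^∨`. -/
def Ad (g : Matrix (Fin 4) (Fin 4) ℝ) : Matrix (Fin 6) (Fin 6) ℝ :=
  Matrix.of fun i j => vee (g * hat (Pi.single j 1) * g⁻¹) i

/-- The adjoint representation of `𝔰𝔢(3)`: `ad_x y = [x̂, ŷ]^∨`. -/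
def ad (x : Vec6) : Matrix (Fin 6) (Fin 6) ℝ :=
  Matrix.of fun i j => vee (hat x * hat (Pi.single j 1) - hat (Pi.single j 1) * hat x) i

/-- The coadjoint representation of `𝔰𝔢(3)` on wrenches, `ad*_x = - (ad_x)ᵀ`; in blocks, for
`x = (ω, ν)`, it is `[[ω̂, ν̂], [0, ω̂]]`. -/
def coad (x : Vec6) : Matrix (Fin 6) (Fin 6) ℝ := -(ad x)ᵀ

/-- The Euclidean norm of the translational part of a twist. -/
def translationNorm (x : Vec6) : ℝ := √(x 3 ^ 2 + x 4 ^ 2 + x 5 ^ 2)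

/-- The constant transformation between the inertial frame and the base frame. -/
def gr : Matrix (Fin 4) (Fin 4) ℝ :=
  !![0, -1, 0, 0;
     1, 0, 0, 0;
     0, 0, 1, 0;
     0, 0, 0, 1]

/-! ### The piecewise constant strain (PCS) robot -/

/-- Joint vectors `q = (ξ₁, …, ξ_N) ∈ ℝ^{6N}`: one constant strain in `ℝ⁶` per section. -/
abbrev Config (N : ℕ) : Type := Fin N × Fin 6 → ℝ

/-- The physical data of a PCS robot with `N` sections. -/
structure Robot (N : ℕ) where
  /-- The nodes `0 = L₀ < L₁ < ⋯ < L_N`; section `i` is `[L i.castSucc, L i.succ]`. -/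
  L : Fin (N + 1) → ℝ
  L_zero : L 0 = 0
  L_strictMono : StrictMono L
  /-- Body density. -/
  ρ : ℝ
  ρ_pos : 0 < ρ
  /-- Density of the surrounding fluid. -/
  ρf : ℝ
  ρf_nonneg : 0 ≤ ρf
  /-- Second moments of area and area of the cross-section at abscissa `X`. -/
  Ix : ℝ → ℝ
  Iy : ℝ → ℝ
  Iz : ℝ → ℝ
  area : ℝ → ℝ
  Ix_pos : ∀ X ∈ Set.Icc 0 (L (Fin.last N)), 0 < Ix X
  Iy_pos : ∀ X ∈ Set.Icc 0 (L (Fin.last N)), 0 < Iy X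
  Iz_pos : ∀ X ∈ Set.Icc 0 (L (Fin.last N)), 0 < Iz X
  area_pos : ∀ X ∈ Set.Icc 0 (L (Fin.last N)), 0 < area X
  Ix_integrable : IntervalIntegrable Ix MeasureTheory.volume 0 (L (Fin.last N))
  Iy_integrable : IntervalIntegrable Iy MeasureTheory.volume 0 (L (Fin.last N))
  Iz_integrable : IntervalIntegrable Iz MeasureTheory.volume 0 (L (Fin.last N))
  area_integrable : IntervalIntegrable area MeasureTheory.volume 0 (L (Fin.last N))
  /-- Inertia operator of the added mass of the fluid. -/
  addedMass : ℝ → Matrix (Fin 6) (Fin 6) ℝ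
  addedMass_posSemidef : ∀ X ∈ Set.Icc 0 (L (Fin.last N)), (addedMass X).PosSemidef
  addedMass_integrable : ∀ i j, IntervalIntegrable (fun X => addedMass X i j)
    MeasureTheory.volume 0 (L (Fin.last N))
  /-- Drag matrix; drag never supplies power. -/
  drag : ℝ → Matrix (Fin 6) (Fin 6) ℝ
  drag_nonneg : ∀ X ∈ Set.Icc 0 (L (Fin.last N)), ∀ w : Vec6, 0 ≤ w ⬝ᵥ (drag X *ᵥ w)
  drag_integrable : ∀ i j, IntervalIntegrable (fun X => drag X i j)
    MeasureTheory.volume 0 (L (Fin.last N))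
  /-- Gravitational acceleration (`9.81` on earth, `0` in the absence of gravity). -/
  gravAccel : ℝ
  /-- The cable, if there is one: the abscissa at which it acts and the wrench it applies there. -/
  cable : Option (ℝ × Vec6)
  cable_mem : ∀ c ∈ cable, c.1 ∈ Set.Icc 0 (L (Fin.last N))

namespace Robot

variable {N : ℕ} (R : Robot N)

/-- The total length `L_N`. -/
def len : ℝ := R.L (Fin.last N)

/-- The length of the part of section `i` that lies in `[0, X]`. -/
def arc (i : Fin N) (X : ℝ) : ℝ := max 0 (min X (R.L i.succ) - R.L i.castSucc)

/-- The pose at abscissa `X` relative to the base, i.e. the solution of `∂g/∂X = g ξ̂`, `g(0) = 1`,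
for the piecewise constant strain `ξ = q i` on section `i`: an ordered product of exponentials. -/
def pose (X : ℝ) (q : Config N) : Matrix (Fin 4) (Fin 4) ℝ :=
  (List.ofFn fun i : Fin N => NormedSpace.exp (R.arc i X • hat fun j => q (i, j))).prod

/-- The geometric Jacobian `J(X)` at `q`: column `k` is `(g⁻¹ ∂g/∂q_k)^∨`, so that the velocity twist
`(g⁻¹ ∂g/∂t)^∨` equals `J q̇`. -/
def J (X : ℝ) (q : Config N) : Matrix (Fin 6) (Fin N × Fin 6) ℝ :=
  Matrix.of fun i k => vee ((R.pose X q)⁻¹ *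
    Matrix.of fun a b => lineDeriv ℝ (fun p => R.pose X p a b) q (Pi.single k 1)) i

/-- The time derivative of `J(X)` at `q` when `q` moves with velocity `v`. -/
def Jdot (X : ℝ) (q v : Config N) : Matrix (Fin 6) (Fin N × Fin 6) ℝ :=
  Matrix.of fun i k => lineDeriv ℝ (fun p => R.J X p i k) q v

/-- The screw mass inertia matrix of the body. -/
def mass (X : ℝ) : Matrix (Fin 6) (Fin 6) ℝ :=
  R.ρ • Matrix.diagonal ![R.Ix X, R.Iy X, R.Iz X, R.area X, R.area X, R.area X]

/-- The lumped inertia of the body and of the added mass of the fluid. -/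
def totalMass (X : ℝ) : Matrix (Fin 6) (Fin 6) ℝ := R.mass X + R.addedMass X

/-- Entrywise integral of a matrix field along the robot. -/
def integral {m n : Type*} (A : ℝ → Matrix m n ℝ) : Matrix m n ℝ :=
  Matrix.of fun i j => ∫ X in (0 : ℝ)..R.len, A X i j

/-- The generalized mass matrix `M(q)`. -/
def M (q : Config N) : Matrix (Fin N × Fin 6) (Fin N × Fin 6) ℝ :=
  R.integral fun X => (R.J X q)ᵀ * R.totalMass X * R.J X q

/-- The first Coriolis matrix `C₁(q, q̇)`. -/
def C₁ (q v : Config N) : Matrix (Fin N × Fin 6) (Fin N × Fin 6) ℝ :=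
  R.integral fun X => (R.J X q)ᵀ * coad (R.J X q *ᵥ v) * R.totalMass X * R.J X q

/-- The second Coriolis matrix `C₂(q, q̇)`. -/
def C₂ (q v : Config N) : Matrix (Fin N × Fin 6) (Fin N × Fin 6) ℝ :=
  R.integral fun X => (R.J X q)ᵀ * R.totalMass X * R.Jdot X q v

/-- The drag matrix `D(q, q̇)`. -/
def D (q v : Config N) : Matrix (Fin N × Fin 6) (Fin N × Fin 6) ℝ :=
  R.integral fun X =>
    translationNorm (R.J X q *ᵥ v) • ((R.J X q)ᵀ * R.drag X * R.J X q)

/-- The matrix `N(q)` of the gravity-buoyancy term. -/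
def gravMatrix (q : Config N) : Matrix (Fin N × Fin 6) (Fin 6) ℝ :=
  (1 - R.ρf / R.ρ) • R.integral fun X => (R.J X q)ᵀ * R.mass X * (Ad (R.pose X q))⁻¹

/-- The gravitational vector. -/
def gravVector : Vec6 := ![0, 0, 0, -R.gravAccel, 0, 0]

/-- The generalized gravity-buoyancy force `N(q) Ad_{g_r}⁻¹ 𝒢`. -/
def gravForce (q : Config N) : Config N := R.gravMatrix q *ᵥ ((Ad gr)⁻¹ *ᵥ R.gravVector)

/-- The generalized force `F(q) = J(X̄)ᵀ F_p` of the wrench `F_p` that the cable applies at `X̄`. -/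
def F (q : Config N) : Config N :=
  match R.cable with
  | none => 0
  | some c => (R.J c.1 q)ᵀ *ᵥ c.2

/-- The equation of motion
`M(q) q̈ + [C₁(q, q̇) + C₂(q, q̇)] q̇ = u + F(q) + N(q) Ad_{g_r}⁻¹ 𝒢 - D(q, q̇) q̇`
in which the generalized torque `u` is the control input; here `v = q̇` and `a = q̈`. -/
def EquationOfMotion (q v a u : Config N) : Prop :=
  R.M q *ᵥ a + (R.C₁ q v + R.C₂ q v) *ᵥ v = u + R.F q + R.gravForce q - R.D q v *ᵥ v

/-- The closed-loop system under the state feedback `u(q, q̇)`, as a relation between the state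
`x = (q, q̇)` and its velocity `x' = (q̇, q̈)`. -/
def ClosedLoop (u : Config N → Config N → Config N) (x x' : Config N × Config N) : Prop :=
  x'.1 = x.2 ∧ R.EquationOfMotion x.1 x.2 x'.2 (u x.1 x.2)

end Robot

/-- The plain PD law `u(q, q̇) = - K_p (q - q^d) - K_D q̇`. -/
def pdLaw {N : ℕ} (Kp Kd : Matrix (Fin N × Fin 6) (Fin N × Fin 6) ℝ) (qd : Config N)
    (q v : Config N) : Config N :=
  -(Kp *ᵥ (q - qd)) - Kd *ᵥ v

/-! ### Global asymptotic stability -/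

section Stability

variable {E : Type*} [NormedAddCommGroup E] [NormedSpace ℝ E]

/-- `x` solves, on the time set `I`, the autonomous system given by the relation `Φ` between
states and velocities. -/
def IsSolutionOn (Φ : E → E → Prop) (I : Set ℝ) (x : ℝ → E) : Prop :=
  ∀ t ∈ I, ∃ x' : E, HasDerivWithinAt x x' I t ∧ Φ (x t) x'

/-- `xe` is a globally asymptotically stable equilibrium of the system `Φ`. -/
structure IsGAS (Φ : E → E → Prop) (xe : E) : Prop where
  equilibrium : Φ xe 0
  /-- From each initial state there is a solution for all positive times, and every other solution
  from that state, be it for all positive times or up to a finite time, is a part of it. -/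
  wellPosed : ∀ x₀ : E, ∃ x : ℝ → E, IsSolutionOn Φ (Set.Ici 0) x ∧ x 0 = x₀ ∧
    ∀ (T : ℝ) (y : ℝ → E), IsSolutionOn Φ (Set.Ico 0 T) y → y 0 = x₀ → Set.EqOn y x (Set.Ico 0 T)
  stable : ∀ ε > 0, ∃ δ > 0, ∀ x : ℝ → E, IsSolutionOn Φ (Set.Ici 0) x →
    ‖x 0 - xe‖ < δ → ∀ t ≥ 0, ‖x t - xe‖ < ε
  attractive : ∀ x : ℝ → E, IsSolutionOn Φ (Set.Ici 0) x →
    Filter.Tendsto x Filter.atTop (nhds xe)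

end Stability

end PCS

end

/-! Without cable and net gravity, let E be the kinetic energy plus the energy of a virtual spring
of stiffness `Kp`. Differentiating under the integral gives dM/dt = C₂ + C₂ᵀ (`hasFDerivAt_M`), and
C₁ does no work because `ad x *ᵥ x = 0` (`dotProduct_C₁_mulVec`). So all inertial terms cancel in
the power balance, and E' = -vᵀ Kd v - vᵀ D v ≤ 0 (`hasDerivAlong_energy`).

This dissipation vanishes at v = 0 whatever the position. In place of an invariance principle, the
proof adds a small multiple of the cross term eᵀ M v, where e = q - qd. On each sublevel set of E,
which is compact, a suitable weight makes the sum comparable to E and strictly decaying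
(`exists_strict_lyapunov`). The weight and the rate depend on the level, but a trajectory never
leaves the sublevel set of its initial state. Hence E tends to 0 along it, and the state converges
because E is proper and vanishes only at the equilibrium. Stability follows from E alone
(`isGAS_of_lyapunov`).

Two facts carry the rest. First, M(q) is positive definite (`posDef_M`): if J(X) v = 0 for all X,
then v = 0, as one sees section by section near its left node, where the differential of the
exponential is close to the identity (`eq_zero_of_chainJac`). This makes the equation of motion an
explicit ODE and sublevel sets of E bounded. Second, the field of that ODE is locally Lipschitz. The
material data are only integrable in X, and the arc lengths only continuous, so smoothness is
established in the pair (arc lengths, q) and integrated afterwards; the drag is limited to Lipschitz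
regularity by the Euclidean norm. Global existence then follows by truncating the field outside a
ball that contains the sublevel set. -/

noncomputable section

namespace PCS

/-! ### Global existence, uniqueness and asymptotic stability from Lyapunov functions. -/

section Dynamics

open Set Filter Metric
open scoped Topology NNReal

variable {E : Type*} [NormedAddCommGroup E] [NormedSpace ℝ E]

/-- `V'` is the derivative of `V` along the trajectories of the vector field `f`. -/
def HasDerivAlong (f : E → E) (V V' : E → ℝ) : Prop :=
  ∀ (x : ℝ → E) (s : Set ℝ) (t : ℝ), HasDerivWithinAt x (f (x t)) s t →
    HasDerivWithinAt (fun τ => V (x τ)) (V' (x t)) s t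

/-- Up to any b < T both trajectories trace out compact sets, on whose union f is Lipschitz, so the
usual uniqueness theorem applies. -/
theorem eqOn_Ico_of_solution [ProperSpace E] {f : E → E} (hf : LocallyLipschitz f) {T : ℝ}
    {x y : ℝ → E} (hx : ∀ t ∈ Ico 0 T, HasDerivWithinAt x (f (x t)) (Ico 0 T) t)
    (hy : ∀ t ∈ Ico 0 T, HasDerivWithinAt y (f (y t)) (Ico 0 T) t) (h0 : x 0 = y 0) :
    EqOn x y (Ico 0 T) := by
  intro b hb
  have hsub : Icc 0 b ⊆ Ico 0 T := fun t ht => ⟨ht.1, ht.2.trans_lt hb.2⟩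
  have hxc : ContinuousOn x (Icc 0 b) := fun t ht =>
    ((hx t (hsub ht)).continuousWithinAt).mono hsub
  have hyc : ContinuousOn y (Icc 0 b) := fun t ht =>
    ((hy t (hsub ht)).continuousWithinAt).mono hsub
  have hK : IsCompact (x '' Icc 0 b ∪ y '' Icc 0 b) :=
    (isCompact_Icc.image_of_continuousOn hxc).union (isCompact_Icc.image_of_continuousOn hyc)
  obtain ⟨K, hKf⟩ := (hf.locallyLipschitzOn (s := x '' Icc 0 b ∪ y '' Icc 0 b)
    ).exists_lipschitzOnWith_of_compact hK
  have hnhds : ∀ t ∈ Ico 0 b, Ico 0 T ∈ 𝓝[Ici t] t := fun t ht =>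
    mem_of_superset (Ico_mem_nhdsGE (ht.2.trans hb.2)) (Ico_subset_Ico_left ht.1)
  exact ODE_solution_unique_of_mem_Icc_right (v := fun _ => f)
    (s := fun _ => x '' Icc 0 b ∪ y '' Icc 0 b) (fun _ _ => hKf) hxc
    (fun t ht => (hx t (hsub (Ico_subset_Icc_self ht))).mono_of_mem_nhdsWithin (hnhds t ht))
    (fun t ht => Or.inl (mem_image_of_mem _ (Ico_subset_Icc_self ht))) hyc
    (fun t ht => (hy t (hsub (Ico_subset_Icc_self ht))).mono_of_mem_nhdsWithin (hnhds t ht))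
    (fun t ht => Or.inr (mem_image_of_mem _ (Ico_subset_Icc_self ht))) h0 ⟨hb.1, le_rfl⟩

/-- At speed at most C a trajectory stays within distance C n of its start up to time n, so
Picard–Lindelöf on that ball covers all of [0, n] at once. Uniqueness glues the pieces. -/
theorem exists_solution_Ici_of_bounded [ProperSpace E] {f : E → E} (hf : LocallyLipschitz f)
    {C : ℝ≥0} (hC : ∀ x, ‖f x‖ ≤ C) (x₀ : E) :
    ∃ x : ℝ → E, x 0 = x₀ ∧ ∀ t ∈ Ici (0 : ℝ), HasDerivWithinAt x (f (x t)) (Ici 0) t := by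
  have hloc : ∀ n : ℕ, ∃ α : ℝ → E, α 0 = x₀ ∧
      ∀ t ∈ Icc (0 : ℝ) n, HasDerivWithinAt α (f (α t)) (Icc 0 n) t := by
    intro n
    obtain ⟨K, hK⟩ := (hf.locallyLipschitzOn (s := closedBall x₀ (C * n : ℝ≥0))
      ).exists_lipschitzOnWith_of_compact (isCompact_closedBall _ _)
    have hpl : IsPicardLindelof (fun _ => f) (tmin := 0) (tmax := n)
        ⟨0, left_mem_Icc.2 n.cast_nonneg⟩ x₀ (C * n) 0 C K :=
      IsPicardLindelof.of_time_independent (fun x _ => hC x) hK (by simp)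
    exact hpl.exists_eq_forall_mem_Icc_hasDerivWithinAt₀
  choose α hα0 hα using hloc
  have hα' : ∀ n : ℕ, ∀ t ∈ Ico (0 : ℝ) n, HasDerivWithinAt (α n) (f (α n t)) (Ico 0 n) t :=
    fun n t ht => (hα n t (Ico_subset_Icc_self ht)).mono Ico_subset_Icc_self
  have hmono : ∀ m n : ℕ, m ≤ n → EqOn (α m) (α n) (Ico 0 m) := by
    intro m n hmn
    have hs : Ico (0 : ℝ) m ⊆ Ico 0 n := Ico_subset_Ico_right (by exact_mod_cast hmn)
    exact eqOn_Ico_of_solution hf (hα' m) (fun t ht => (hα' n t (hs ht)).mono hs)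
      ((hα0 m).trans (hα0 n).symm)
  -- The shift by one puts t strictly before the end of the interval of its piece, so that the
  -- derivative there is also the derivative within `Ici 0`.
  let x : ℝ → E := fun t => α (⌊t⌋₊ + 1) t
  have hx : ∀ n : ℕ, EqOn x (α n) (Ico 0 n) := by
    intro n t ht
    refine hmono _ _ ?_ ⟨ht.1, by exact_mod_cast Nat.lt_floor_add_one t⟩
    exact (Nat.floor_lt ht.1).2 ht.2
  refine ⟨x, by simp [x, hα0], fun t ht => ?_⟩
  have htn : t ∈ Ico (0 : ℝ) (⌊t⌋₊ + 1 : ℕ) := ⟨ht, by exact_mod_cast Nat.lt_floor_add_one t⟩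
  have h1 := (hα' _ t htn).congr_of_mem (hx _) htn
  rw [← hx _ htn] at h1
  refine h1.mono_of_mem_nhdsWithin ?_
  rw [← Ici_inter_Iio]
  exact inter_mem_nhdsWithin _ (Iio_mem_nhds htn.2)

/-- A locally Lipschitz vector field agrees on each ball with a bounded one. -/
theorem exists_bounded_eqOn_ball [ProperSpace E] {f : E → E} (hf : LocallyLipschitz f) (r : ℝ) :
    ∃ (g : E → E) (C : ℝ≥0), LocallyLipschitz g ∧ (∀ x, ‖g x‖ ≤ C) ∧
      EqOn g f (closedBall 0 r) := by
  let χ : E → ℝ := fun x => max 0 (min 1 (r + 1 - ‖x‖))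
  have hχ : LocallyLipschitz χ := by
    refine LocallyLipschitz.const_max (LocallyLipschitz.const_min ?_ 1) 0
    have h : LipschitzWith (0 + 1) fun x : E => (r + 1) - ‖x‖ :=
      (LipschitzWith.const (r + 1)).sub lipschitzWith_one_norm
    exact h.locallyLipschitz
  have hχf : LocallyLipschitz fun x => χ x • f x :=
    (contDiff_smul (𝕜 := ℝ) (F := E) (n := 1)).locallyLipschitz.comp (hχ.prodMk hf)
  obtain ⟨C, hC⟩ := (isCompact_closedBall (0 : E) (r + 1)).exists_bound_of_continuousOn
    hχf.continuous.continuousOn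
  refine ⟨_, C.toNNReal, hχf, fun x => ?_, fun x hx => ?_⟩
  · rw [Real.coe_toNNReal']
    by_cases hx : x ∈ closedBall (0 : E) (r + 1)
    · exact le_max_of_le_left (hC x hx)
    · have h0 : χ x = 0 := by
        rw [mem_closedBall_zero_iff, not_le] at hx
        exact max_eq_left ((min_le_right _ _).trans (by linarith))
      simp [h0]
  · have h1 : χ x = 1 := by
      rw [mem_closedBall_zero_iff] at hx
      simp only [χ]
      rw [min_eq_left (by linarith), max_eq_right zero_le_one]
    simp [h1]

theorem antitoneOn_along_solution {f : E → E} {V V' : E → ℝ} (hV : HasDerivAlong f V V')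
    (hV' : ∀ x, V' x ≤ 0) {D : Set ℝ} (hD : Convex ℝ D) {x : ℝ → E}
    (hx : ∀ t ∈ D, HasDerivWithinAt x (f (x t)) D t) : AntitoneOn (fun t => V (x t)) D :=
  antitoneOn_of_hasDerivWithinAt_nonpos hD
    (fun t ht => (hV x D t (hx t ht)).continuousWithinAt)
    (fun t ht => (hV x D t (hx t (interior_subset ht))).mono interior_subset)
    (fun _ _ => hV' _)

/-- The truncated field has a global solution. It stays in the initial sublevel set of V, where the
truncation changes nothing, so it also solves the original equation. -/
theorem exists_solution_Ici_of_lyapunov [ProperSpace E] {f : E → E} (hf : LocallyLipschitz f)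
    {V V' : E → ℝ} (hVc : Continuous V) (hV : HasDerivAlong f V V') (hV' : ∀ x, V' x ≤ 0)
    (hbdd : ∀ c, Bornology.IsBounded {x | V x ≤ c}) (x₀ : E) :
    ∃ x : ℝ → E, x 0 = x₀ ∧ ∀ t ∈ Ici (0 : ℝ), HasDerivWithinAt x (f (x t)) (Ici 0) t := by
  obtain ⟨r, hr⟩ := (hbdd (V x₀)).subset_ball (0 : E)
  obtain ⟨g, C, hg, hC, hgf⟩ := exists_bounded_eqOn_ball hf r
  obtain ⟨x, hx0, hx⟩ := exists_solution_Ici_of_bounded hg hC x₀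
  have hxc : ContinuousOn x (Ici 0) := fun t ht => (hx t ht).continuousWithinAt
  have hlev : ∀ t ∈ Ici (0 : ℝ), V (x t) ≤ V x₀ := by
    intro b hb
    -- Continuity method: the set of good times is closed, and from each of them it extends to the
    -- right. The sublevel set lies in the open ball, so for a short while x remains where g = f,
    -- and there V decreases.
    have hsub : Icc 0 b ⊆ {t | V (x t) ≤ V x₀} := by
      refine IsClosed.Icc_subset_of_forall_exists_gt ?_ (by simp [hx0]) ?_
      · have hc : ContinuousOn (fun t => V (x t)) (Icc 0 b) :=
          hVc.comp_continuousOn (hxc.mono Icc_subset_Ici_self)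
        have := hc.preimage_isClosed_of_isClosed isClosed_Icc (isClosed_Iic (a := V x₀))
        rwa [inter_comm] at this
      · rintro t ⟨ht, ht0, -⟩ y hy
        have hnear : ∀ᶠ τ in 𝓝[≥] t, x τ ∈ ball (0 : E) r :=
          ((hxc t ht0).mono (Ici_subset_Ici.2 ht0)) (isOpen_ball.mem_nhds (hr ht))
        obtain ⟨u, hu, hux⟩ := mem_nhdsGE_iff_exists_Icc_subset.1 hnear
        have hant : AntitoneOn (fun t => V (x t)) (Icc t (min u y)) := by
          refine antitoneOn_along_solution hV hV' (convex_Icc _ _) fun τ hτ => ?_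
          rw [← hgf (ball_subset_closedBall (hux ⟨hτ.1, hτ.2.trans (min_le_left _ _)⟩))]
          exact (hx τ (ht0.trans hτ.1)).mono fun σ hσ => ht0.trans hσ.1
        have hlt : t < min u y := lt_min hu hy
        exact ⟨min u y, (hant (left_mem_Icc.2 hlt.le) (right_mem_Icc.2 hlt.le) hlt.le).trans ht,
          hlt, min_le_right _ _⟩
    exact hsub ⟨hb, le_rfl⟩
  refine ⟨x, hx0, fun t ht => ?_⟩
  rw [← hgf (ball_subset_closedBall (hr (hlev t ht)))]
  exact hx t ht

/-- Small values of a proper positive definite function are only taken near its zero. -/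
theorem exists_pos_forall_lt_norm_sub_lt {E : Type*} [NormedAddCommGroup E] [ProperSpace E]
    {V : E → ℝ} (hVc : Continuous V)
    {xe : E} (hpos : ∀ x ≠ xe, 0 < V x) (hbdd : ∀ c, Bornology.IsBounded {x | V x ≤ c})
    {ε : ℝ} (hε : 0 < ε) : ∃ η > 0, ∀ x, V x < η → ‖x - xe‖ < ε := by
  have hK : IsCompact ({x | V x ≤ 1} ∩ {x | ε ≤ ‖x - xe‖}) :=
    (isCompact_of_isClosed_isBounded (isClosed_le hVc continuous_const) (hbdd 1)).inter_right
      (isClosed_le continuous_const (by fun_prop))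
  rcases eq_empty_or_nonempty ({x | V x ≤ 1} ∩ {x | ε ≤ ‖x - xe‖}) with h | h
  · refine ⟨1, one_pos, fun x hx => not_le.1 fun hxe => ?_⟩
    exact h.subset ⟨hx.le, hxe⟩
  · obtain ⟨z, hz, hmin⟩ := hK.exists_isMinOn h hVc.continuousOn
    have hzpos : 0 < V z := hpos z fun hze => by
      have := hz.2
      simp only [hze, mem_ofPred_eq, sub_self, norm_zero] at this
      linarith
    refine ⟨min 1 (V z), lt_min one_pos hzpos, fun x hx => not_le.1 fun hxe => ?_⟩
    exact (hx.trans_le (min_le_right _ _)).not_ge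
      (hmin ⟨(hx.trans_le (min_le_left _ _)).le, hxe⟩)

/-- Global asymptotic stability from a proper Lyapunov function which on each of its sublevel sets
is dominated by an exponentially decaying one. -/
theorem isGAS_of_lyapunov [ProperSpace E] {Φ : E → E → Prop} {f : E → E} {xe : E}
    {V V' : E → ℝ} (hΦ : ∀ x x', Φ x x' ↔ x' = f x) (hf : LocallyLipschitz f) (hfe : f xe = 0)
    (hVc : Continuous V) (hVe : V xe = 0) (hpos : ∀ x ≠ xe, 0 < V x)
    (hbdd : ∀ c, Bornology.IsBounded {x | V x ≤ c})
    (hV : HasDerivAlong f V V') (hV' : ∀ x, V' x ≤ 0)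
    (hW : ∀ c, ∃ (W W' : E → ℝ) (κ : ℝ), 0 < κ ∧ HasDerivAlong f W W' ∧
      ∀ x, V x ≤ c → V x ≤ W x ∧ W' x ≤ -κ * W x) :
    IsGAS Φ xe := by
  have hsol : ∀ {I : Set ℝ} {x : ℝ → E}, IsSolutionOn Φ I x ↔
      ∀ t ∈ I, HasDerivWithinAt x (f (x t)) I t := by
    intro I x
    simp [IsSolutionOn, hΦ]
  have hanti : ∀ {x : ℝ → E}, IsSolutionOn Φ (Ici 0) x → ∀ t ≥ 0, V (x t) ≤ V (x 0) :=
    fun hx t ht => antitoneOn_along_solution hV hV' (convex_Ici 0) (hsol.1 hx) self_mem_Ici ht ht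
  refine ⟨(hΦ _ _).2 hfe.symm, fun x₀ => ?_, fun ε hε => ?_, fun x hx => ?_⟩
  · obtain ⟨x, hx0, hx⟩ := exists_solution_Ici_of_lyapunov hf hVc hV hV' hbdd x₀
    refine ⟨x, hsol.2 hx, hx0, fun T y hy hy0 => ?_⟩
    exact eqOn_Ico_of_solution hf (hsol.1 hy)
      (fun t ht => (hx t ht.1).mono Ico_subset_Ici_self) (hy0.trans hx0.symm)
  · obtain ⟨η, hη, hηε⟩ := exists_pos_forall_lt_norm_sub_lt hVc hpos hbdd hε
    have hnear : ∀ᶠ x in 𝓝 xe, V x < η :=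
      hVc.continuousAt.eventually (Iio_mem_nhds (by rwa [hVe]))
    obtain ⟨δ, hδ, hδV⟩ := Metric.eventually_nhds_iff.1 hnear
    refine ⟨δ, hδ, fun x hx hx0 t ht => hηε _ ((hanti hx t ht).trans_lt (hδV ?_))⟩
    rwa [dist_eq_norm]
  -- The strict function is chosen for the level of the initial state; no rate uniform over all
  -- states is needed.
  · obtain ⟨W, W', κ, hκ, hWd, hWV⟩ := hW (V (x 0))
    have hdec : AntitoneOn (fun t => W (x t) * Real.exp (κ * t)) (Ici 0) := by
      have hder : ∀ t ∈ Ici (0 : ℝ), HasDerivWithinAt (fun t => W (x t) * Real.exp (κ * t))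
          (W' (x t) * Real.exp (κ * t) + W (x t) * (Real.exp (κ * t) * (κ * 1))) (Ici 0) t :=
        fun t ht => (hWd x _ t (hsol.1 hx t ht)).mul
          (((hasDerivAt_id t).const_mul κ).exp).hasDerivWithinAt
      refine antitoneOn_of_hasDerivWithinAt_nonpos (convex_Ici 0)
        (fun t ht => (hder t ht).continuousWithinAt)
        (fun t ht => (hder t (interior_subset ht)).mono interior_subset) fun t ht => ?_
      have h1 := (hWV (x t) (hanti hx t (interior_subset ht))).2
      nlinarith [Real.exp_pos (κ * t)]
    have hVle : ∀ t ≥ 0, V (x t) ≤ W (x 0) * Real.exp (-(κ * t)) := by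
      intro t ht
      refine ((hWV (x t) (hanti hx t ht)).1).trans ?_
      have h1 := hdec self_mem_Ici ht ht
      simp only [mul_zero, Real.exp_zero, mul_one] at h1
      calc W (x t) = W (x t) * Real.exp (κ * t) * Real.exp (-(κ * t)) := by
            rw [mul_assoc, ← Real.exp_add]; simp
        _ ≤ _ := by gcongr
    have hlim : Tendsto (fun t : ℝ => W (x 0) * Real.exp (-(κ * t))) atTop (𝓝 0) := by
      simpa using (Real.tendsto_exp_neg_atTop_nhds_zero.comp
        (tendsto_id.const_mul_atTop hκ)).const_mul (W (x 0))
    rw [tendsto_iff_norm_sub_tendsto_zero, Metric.tendsto_atTop]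
    intro ε hε
    obtain ⟨η, hη, hηε⟩ := exists_pos_forall_lt_norm_sub_lt hVc hpos hbdd hε
    obtain ⟨T, hT⟩ := eventually_atTop.1 (hlim.eventually (Iio_mem_nhds hη))
    refine ⟨max T 0, fun t ht => ?_⟩
    have := hηε (x t) ((hVle t ((le_max_right _ _).trans ht)).trans_lt
      (hT t ((le_max_left _ _).trans ht)))
    simpa using this

end Dynamics

/-! ### The chain of exponentials as a function of arc lengths and strains, and its rigid-motion
invariants. -/

section Kinematics

/-- `hat` as a linear map. -/
def hatₗ : Vec6 →ₗ[ℝ] Matrix (Fin 4) (Fin 4) ℝ where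
  toFun := hat
  map_add' x y := by
    ext i j
    fin_cases i <;> fin_cases j <;> simp [hat] <;> ring
  map_smul' c x := by
    ext i j
    fin_cases i <;> fin_cases j <;> simp [hat]

/-- `vee` as a linear map. -/
def veeₗ : Matrix (Fin 4) (Fin 4) ℝ →ₗ[ℝ] Vec6 where
  toFun := vee
  map_add' A B := by
    ext i
    fin_cases i <;> simp [vee]
  map_smul' c A := by
    ext i
    fin_cases i <;> simp [vee]

variable {N : ℕ}

/-- The pose reached after following the strain `q i` along an arc of length `s i`, for all the
sections in turn. -/
def chain (s : Fin N → ℝ) (q : Config N) : Matrix (Fin 4) (Fin 4) ℝ :=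
  (List.ofFn fun i : Fin N => NormedSpace.exp (s i • hat fun j => q (i, j))).prod

theorem isUnit_chain (s : Fin N → ℝ) (q : Config N) : IsUnit (chain s q) := by
  refine List.prod_isUnit fun A hA => ?_
  obtain ⟨i, rfl⟩ := (List.mem_ofFn' _ _).1 hA
  exact Matrix.isUnit_exp _

/-- The derivative of `chain s` at `q` in the direction `v`. -/
def chainDeriv (s : Fin N → ℝ) (q v : Config N) : Matrix (Fin 4) (Fin 4) ℝ :=
  Matrix.of fun a b => lineDeriv ℝ (fun p => chain s p a b) q v

/-- The Jacobian of `chain`. -/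
def chainJac (s : Fin N → ℝ) (q : Config N) : Matrix (Fin 6) (Fin N × Fin 6) ℝ :=
  Matrix.of fun i k => vee ((chain s q)⁻¹ * chainDeriv s q (Pi.single k 1)) i

/-- The derivative of `chainJac s` at `q` in the direction `v`. -/
def chainJacDeriv (s : Fin N → ℝ) (q v : Config N) : Matrix (Fin 6) (Fin N × Fin 6) ℝ :=
  Matrix.of fun i k => lineDeriv ℝ (fun p => chainJac s p i k) q v

/-! ### The velocity twist lies in the Lie algebra -/

/-- The degenerate quadratic form on covectors of homogeneous coordinates preserved by rigid motions. -/
def spatialForm : Matrix (Fin 4) (Fin 4) ℝ := Matrix.diagonal ![1, 1, 1, 0]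

/-- The projection to the homogeneous coordinate. -/
def homogProj : Matrix (Fin 4) (Fin 4) ℝ := Matrix.diagonal ![0, 0, 0, 1]

/-- The product of `hat x` with the form is skew-symmetric, so the form intertwines `-(hat x)ᵀ` with
`hat x`, hence also their exponentials; then the factors exp(-(hat x)ᵀ) and exp((hat x)ᵀ) cancel. -/
theorem exp_hat_spatialForm (x : Vec6) :
    NormedSpace.exp (hat x) * spatialForm * (NormedSpace.exp (hat x))ᵀ = spatialForm := by
  have h : SemiconjBy spatialForm (-(hat x)ᵀ) (hat x) := by
    ext i j
    fin_cases i <;> fin_cases j <;> simp [spatialForm, hat]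
  have h' : SemiconjBy spatialForm (NormedSpace.exp (-(hat x)ᵀ)) (NormedSpace.exp (hat x)) := by
    open scoped Matrix.Norms.Operator in exact h.exp_right
  rw [← h'.eq, ← Matrix.exp_transpose, mul_assoc, ← Matrix.exp_add_of_commute]
  · simp
  · exact (Commute.refl _).neg_left

theorem homogProj_exp_hat (x : Vec6) : homogProj * NormedSpace.exp (hat x) = homogProj := by
  have h : SemiconjBy homogProj (hat x) 0 := by
    ext i j
    fin_cases i <;> fin_cases j <;> simp [homogProj, hat]
  have h' : SemiconjBy homogProj (NormedSpace.exp (hat x)) (NormedSpace.exp 0) := by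
    open scoped Matrix.Norms.Operator in exact h.exp_right
  simpa using h'.eq

/-- Together the equations say that the last row is (0, 0, 0, 1) and the rotation block is
orthogonal. Both properties pass to products. -/
theorem chain_invariants (s : Fin N → ℝ) (q : Config N) :
    chain s q * spatialForm * (chain s q)ᵀ = spatialForm ∧ homogProj * chain s q = homogProj := by
  refine List.prod_induction (fun P : Matrix (Fin 4) (Fin 4) ℝ =>
    P * spatialForm * Pᵀ = spatialForm ∧ homogProj * P = homogProj) ?_ ?_ ?_
  · rintro A B ⟨hA, hA'⟩ ⟨hB, hB'⟩
    refine ⟨?_, by rw [← mul_assoc, hA', hB']⟩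
    calc A * B * spatialForm * (A * B)ᵀ = A * (B * spatialForm * Bᵀ) * Aᵀ := by
          simp only [Matrix.transpose_mul, mul_assoc]
      _ = _ := by rw [hB, hA]
  · simp
  · intro A hA
    obtain ⟨i, rfl⟩ := (List.mem_ofFn' _ _).1 hA
    have : (s i • hat fun j => q (i, j)) = hat (s i • fun j => q (i, j)) :=
      (hatₗ.map_smul (s i) fun j => q (i, j)).symm
    simp only [this]
    exact ⟨exp_hat_spatialForm _, homogProj_exp_hat _⟩

/-- The hypotheses are the linearized invariants: a skew rotation block and a zero last row, which
characterize the range of `hat`. -/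
theorem hat_vee_of_invariants {B : Matrix (Fin 4) (Fin 4) ℝ}
    (h1 : B * spatialForm + spatialForm * Bᵀ = 0) (h2 : homogProj * B = 0) : hat (vee B) = B := by
  have h1' := fun i j => congrFun (congrFun h1 i) j
  have h2' := fun i j => congrFun (congrFun h2 i) j
  simp only [spatialForm, homogProj, Matrix.add_apply, Matrix.mul_diagonal, Matrix.diagonal_mul,
    Matrix.transpose_apply, Matrix.zero_apply] at h1' h2'
  ext i j
  have e1 := h1' i j
  have e2 := h2' i j
  fin_cases i <;> fin_cases j <;> simp [hat, vee] at e1 e2 ⊢ <;> linarith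

end Kinematics

/-! ### Joint smoothness of the Jacobian in arc lengths and strains, and its injectivity along the
arm. -/

section Smoothness

open Set Filter
open scoped Topology ContDiff Matrix.Norms.Operator

variable {N : ℕ}

theorem contDiff_entry {m n : Type*} [Fintype m] [Fintype n] [DecidableEq n]
    {k : WithTop ℕ∞} (i : m) (j : n) : ContDiff ℝ k fun A : Matrix m n ℝ => A i j :=
  (Matrix.entryLinearMap ℝ ℝ i j).toContinuousLinearMap.contDiff

theorem contDiff_ofFn_prod {E A : Type*} [NormedAddCommGroup E] [NormedSpace ℝ E] [NormedRing A]
    [NormedAlgebra ℝ A] {k : WithTop ℕ∞} : ∀ {n : ℕ} {f : Fin n → E → A},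
    (∀ i, ContDiff ℝ k (f i)) → ContDiff ℝ k fun x => (List.ofFn fun i => f i x).prod
  | 0, _, _ => by simpa using contDiff_const
  | n + 1, f, hf => by
    simp only [List.ofFn_succ, List.prod_cons]
    exact (hf 0).mul (contDiff_ofFn_prod fun i => hf i.succ)

theorem contDiff_matrix_exp {n : Type*} [Fintype n] [DecidableEq n] {k : WithTop ℕ∞} :
    ContDiff ℝ k (NormedSpace.exp : Matrix n n ℝ → Matrix n n ℝ) := 
  AnalyticOnNhd.contDiff fun x _ => NormedSpace.exp_analytic x

theorem contDiff_hat {k : WithTop ℕ∞} : ContDiff ℝ k hat :=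
  hatₗ.toContinuousLinearMap.contDiff

theorem contDiff_chain {k : WithTop ℕ∞} :
    ContDiff ℝ k fun p : (Fin N → ℝ) × Config N => chain p.1 p.2 := by
  refine contDiff_ofFn_prod fun i => contDiff_matrix_exp.comp ?_
  exact ContDiff.smul (n := k) (f := fun p : (Fin N → ℝ) × Config N => p.1 i) (by fun_prop)
    (contDiff_hat.comp (f := fun p : (Fin N → ℝ) × Config N => fun j => p.2 (i, j)) (by fun_prop))

theorem contDiff_chain_inv {k : WithTop ℕ∞} :
    ContDiff ℝ k fun p : (Fin N → ℝ) × Config N => (chain p.1 p.2)⁻¹ := by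
  refine contDiff_iff_contDiffAt.2 fun p => ?_
  simp only [Matrix.nonsing_inv_eq_ringInverse]
  obtain ⟨u, hu⟩ := isUnit_chain p.1 p.2
  have h : ContDiffAt ℝ k Ring.inverse (chain p.1 p.2) := hu ▸ contDiffAt_ringInverse ℝ u
  exact h.comp p contDiff_chain.contDiffAt

theorem lineDeriv_prodMk_eq_fderiv {S P : Type*} [NormedAddCommGroup S] [NormedSpace ℝ S]
    [NormedAddCommGroup P] [NormedSpace ℝ P] {F : S × P → ℝ} (hF : Differentiable ℝ F)
    (s : S) (p w : P) :
    lineDeriv ℝ (fun p => F (s, p)) p w = fderiv ℝ F (s, p) (0, w) := by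
  have h : HasFDerivAt (fun p => F (s, p))
      ((fderiv ℝ F (s, p)).comp (ContinuousLinearMap.inr ℝ S P)) p :=
    (hF (s, p)).hasFDerivAt.comp p (hasFDerivAt_prodMk_right s p)
  rw [(h.hasLineDerivAt w).lineDeriv]
  simp

/-- A directional derivative in the second variable is the full derivative applied to (0, w), which
is smooth in point and direction together. -/
theorem contDiff_lineDeriv_prodMk {S P : Type*} [NormedAddCommGroup S] [NormedSpace ℝ S]
    [NormedAddCommGroup P] [NormedSpace ℝ P] {F : S × P → ℝ} (hF : ContDiff ℝ ∞ F) :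
    ContDiff ℝ ∞ fun z : S × P × P => lineDeriv ℝ (fun p => F (z.1, p)) z.2.1 z.2.2 := by
  simp only [lineDeriv_prodMk_eq_fderiv (hF.differentiable (by simp))]
  have h : ContDiff ℝ ∞ (fderiv ℝ F) := hF.fderiv_right (by simp)
  exact (h.comp (f := fun z : S × P × P => (z.1, z.2.1)) (by fun_prop)).clm_apply (by fun_prop)

theorem contDiff_chainDeriv (a b : Fin 4) :
    ContDiff ℝ ∞ fun z : (Fin N → ℝ) × Config N × Config N => chainDeriv z.1 z.2.1 z.2.2 a b :=
  contDiff_lineDeriv_prodMk (F := fun p : (Fin N → ℝ) × Config N => chain p.1 p.2 a b)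
    ((contDiff_entry a b).comp contDiff_chain)

theorem hasFDerivAt_chain (s : Fin N → ℝ) (q : Config N) :
    HasFDerivAt (chain s) (fderiv ℝ (chain s) q) q := by
  have h : ContDiff ℝ ∞ (chain s) :=
    contDiff_chain.comp (f := fun q : Config N => (s, q)) (by fun_prop)
  exact (h.differentiable (by simp) q).hasFDerivAt

theorem chainDeriv_eq_fderiv (s : Fin N → ℝ) (q v : Config N) :
    chainDeriv s q v = fderiv ℝ (chain s) q v := by
  ext a b
  have h := (Matrix.entryLinearMap ℝ ℝ a b).toContinuousLinearMap.hasFDerivAt.comp q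
    (hasFDerivAt_chain s q)
  exact (h.hasLineDerivAt v).lineDeriv

theorem hasLineDerivAt_chain (s : Fin N → ℝ) (q v : Config N) :
    HasLineDerivAt ℝ (chain s) (chainDeriv s q v) q v := by
  rw [chainDeriv_eq_fderiv]
  exact (hasFDerivAt_chain s q).hasLineDerivAt v

theorem contDiff_chainJac (i : Fin 6) (k : Fin N × Fin 6) :
    ContDiff ℝ ∞ fun p : (Fin N → ℝ) × Config N => chainJac p.1 p.2 i k := by
  have h : ∀ a b, ContDiff ℝ ∞ fun p : (Fin N → ℝ) × Config N =>
      ((chain p.1 p.2)⁻¹ * chainDeriv p.1 p.2 (Pi.single k 1)) a b := by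
    intro a b
    simp only [Matrix.mul_apply]
    refine ContDiff.sum fun c _ => ContDiff.mul ?_ ?_
    · exact (contDiff_entry a c).comp contDiff_chain_inv
    · exact (contDiff_chainDeriv c b).comp
        (f := fun p : (Fin N → ℝ) × Config N => (p.1, p.2, Pi.single k 1)) (by fun_prop)
  simp only [chainJac, Matrix.of_apply, vee]
  fin_cases i <;> exact h _ _

theorem chainJac_mulVec (s : Fin N → ℝ) (q v : Config N) :
    chainJac s q *ᵥ v = vee ((chain s q)⁻¹ * chainDeriv s q v) := by
  let T : Config N →ₗ[ℝ] Vec6 := veeₗ ∘ₗ LinearMap.mulLeft ℝ (chain s q)⁻¹ ∘ₗ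
    (fderiv ℝ (chain s) q : Config N →ₗ[ℝ] Matrix (Fin 4) (Fin 4) ℝ)
  have hT : ∀ v, T v = vee ((chain s q)⁻¹ * chainDeriv s q v) := fun v => by
    rw [chainDeriv_eq_fderiv]; rfl
  rw [← hT v, LinearMap.pi_apply_eq_sum_univ T v]
  ext i
  simp only [Matrix.mulVec, dotProduct, chainJac, Matrix.of_apply, Finset.sum_apply,
    Pi.smul_apply, smul_eq_mul]
  refine Finset.sum_congr rfl fun k _ => ?_
  rw [mul_comm, ← hT]
  have : (Pi.single k 1 : Config N) = fun j => if k = j then 1 else 0 := by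
    ext j
    simp [Pi.single_apply, eq_comm]
  rw [this]

theorem contDiff_chainJacDeriv (i : Fin 6) (k : Fin N × Fin 6) :
    ContDiff ℝ ∞ fun z : (Fin N → ℝ) × Config N × Config N =>
      chainJacDeriv z.1 z.2.1 z.2.2 i k :=
  contDiff_lineDeriv_prodMk (F := fun p : (Fin N → ℝ) × Config N => chainJac p.1 p.2 i k)
    (contDiff_chainJac i k)

/-- `vee` reads only six entries, so a vanishing twist tells nothing about the others until g⁻¹ dg
is known to lie in the Lie algebra. That comes from differentiating the two invariants along q + t
v. -/
theorem hat_chainJac_mulVec (s : Fin N → ℝ) (q v : Config N) :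
    hat (chainJac s q *ᵥ v) = (chain s q)⁻¹ * chainDeriv s q v := by
  have hd : HasDerivAt (fun t : ℝ => chain s (q + t • v)) (chainDeriv s q v) 0 :=
    hasLineDerivAt_chain s q v
  have hu := isUnit_chain s q
  have hdet := (Matrix.isUnit_iff_isUnit_det _).1 hu
  have hdT : HasDerivAt (fun t : ℝ => (chain s (q + t • v))ᵀ) (chainDeriv s q v)ᵀ 0 :=
    (Matrix.transposeLinearEquiv (Fin 4) (Fin 4) ℝ ℝ).toLinearMap.toContinuousLinearMap.hasFDerivAt
      |>.comp_hasDerivAt 0 hd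
  set B := (chain s q)⁻¹ * chainDeriv s q v with hB
  have hPB : chainDeriv s q v = chain s q * B := by
    rw [hB, Matrix.mul_nonsing_inv_cancel_left _ _ hdet]
  rw [chainJac_mulVec, ← hB]
  refine hat_vee_of_invariants ?_ ?_
  · have h1 := (hd.mul_const spatialForm).mul hdT
    have h2 : HasDerivAt ((fun t : ℝ => chain s (q + t • v) * spatialForm) *
        fun t : ℝ => (chain s (q + t • v))ᵀ) 0 0 :=
      (hasDerivAt_const (0 : ℝ) spatialForm).congr_of_eventuallyEq
        (Eventually.of_forall fun t => (chain_invariants s (q + t • v)).1)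
    have h3 := h1.unique h2
    simp only [zero_smul, add_zero] at h3
    -- With dg = g B the differentiated invariant factors through the invertible g and gᵀ, which can
    -- be cancelled.
    have h4 : chain s q * (B * spatialForm + spatialForm * Bᵀ) * (chain s q)ᵀ = 0 := by
      rw [← h3, hPB, Matrix.transpose_mul (chain s q) B]
      simp only [mul_add, add_mul, mul_assoc]
    rwa [((Matrix.isUnit_transpose _).2 hu).mul_left_eq_zero, hu.mul_right_eq_zero] at h4
  · have h1 := hd.const_mul homogProj
    have h2 : HasDerivAt (fun t : ℝ => homogProj * chain s (q + t • v)) 0 0 :=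
      (hasDerivAt_const (0 : ℝ) homogProj).congr_of_eventuallyEq
        (Eventually.of_forall fun t => (chain_invariants s (q + t • v)).2)
    have h3 := h1.unique h2
    rwa [hPB, ← mul_assoc, (chain_invariants s q).2] at h3

/-! ### Injectivity of the Jacobian -/

/-- All factors from position i on are trivial, so the new factor ends up at the far right. -/
theorem ofFn_update_prod {A : Type*} [Monoid A] : ∀ {n : ℕ} (f : Fin n → A) (i : Fin n) (a : A),
    (∀ j, i ≤ j → f j = 1) →
      (List.ofFn (Function.update f i a)).prod = (List.ofFn f).prod * a
  | 0, _, i, _, _ => i.elim0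
  | n + 1, f, i, a, h => by
    rw [List.ofFn_succ, List.ofFn_succ, List.prod_cons, List.prod_cons]
    induction i using Fin.cases with
    | zero =>
      have h1 : (fun j : Fin n => f j.succ) = fun _ => 1 := funext fun j => h _ (Fin.zero_le _)
      simp [h1, h 0 le_rfl]
    | succ i =>
      have h1 : (fun j : Fin n => Function.update f i.succ a j.succ) =
          Function.update (fun j : Fin n => f j.succ) i a := by
        ext j
        by_cases hj : j = i
        · simp [hj]
        · simp [hj]
      rw [h1, ofFn_update_prod _ i a fun j hj => h _ (Fin.succ_le_succ_iff.2 hj), mul_assoc,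
        Function.update_of_ne (Fin.succ_ne_zero i).symm]

theorem chain_update (s : Fin N → ℝ) (i : Fin N) (hs : ∀ j, i ≤ j → s j = 0) (h : ℝ)
    (q : Config N) : chain (Function.update s i h) q =
      chain s q * NormedSpace.exp (h • hat fun j => q (i, j)) := by
  rw [chain, chain, ← ofFn_update_prod _ i _ fun j hj => by simp [hs j hj]]
  congr 2
  ext1 j
  by_cases hj : j = i
  · subst hj; simp
  · simp [hj]

/-- In the product rule for chain times last exponential, the term with the derivative of the chain
vanishes, and the invertible chain cancels from the other. The factor h is the inner derivative. -/
theorem exp_deriv_eq_zero_of_chain (s : Fin N → ℝ) (i : Fin N) (hs : ∀ j, i ≤ j → s j = 0) (h : ℝ)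
    (q v : Config N) (h0 : chainDeriv s q v = 0)
    (h1 : chainDeriv (Function.update s i h) q v = 0) :
    h • fderiv ℝ (NormedSpace.exp : Matrix (Fin 4) (Fin 4) ℝ → _) (h • hat fun j => q (i, j))
      (hat fun j => v (i, j)) = 0 := by
  have hd0 : HasDerivAt (fun t : ℝ => chain s (q + t • v)) 0 0 := h0 ▸ hasLineDerivAt_chain s q v
  have hd1 : HasDerivAt (fun t : ℝ => chain (Function.update s i h) (q + t • v)) 0 0 :=
    h1 ▸ hasLineDerivAt_chain _ q v
  have hexp : Differentiable ℝ (NormedSpace.exp : Matrix (Fin 4) (Fin 4) ℝ → _) :=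
    contDiff_matrix_exp.differentiable one_ne_zero
  set x : Vec6 := fun j => q (i, j)
  set w : Vec6 := fun j => v (i, j)
  have hlin : HasDerivAt (fun t : ℝ => h • hat (x + t • w)) (h • hat w) 0 := by
    have : (fun t : ℝ => h • hat (x + t • w)) = fun t : ℝ => h • hat x + t • h • hat w := by
      funext t
      rw [show hat (x + t • w) = hat x + t • hat w by
        simpa [hatₗ] using hatₗ.map_add x (t • w), smul_add, smul_comm]
    rw [this]
    have h2 := ((hasDerivAt_id (0 : ℝ)).smul_const (h • hat w)).const_add (h • hat x)
    rwa [one_smul] at h2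
  have hde := (hexp (h • hat (x + (0 : ℝ) • w))).hasFDerivAt.comp_hasDerivAt 0 hlin
  have hprod := hd0.mul hde
  have heq : (fun t : ℝ => chain (Function.update s i h) (q + t • v)) =
      (fun t : ℝ => chain s (q + t • v)) *
        ((NormedSpace.exp : Matrix (Fin 4) (Fin 4) ℝ → _) ∘ fun t : ℝ => h • hat (x + t • w)) := by
    funext t
    exact chain_update s i hs h _
  rw [heq] at hd1
  have := hprod.unique hd1
  simp only [zero_smul, add_zero, zero_mul, zero_add] at this
  rw [(isUnit_chain s q).mul_right_eq_zero] at this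
  exact ((fderiv ℝ (NormedSpace.exp : Matrix (Fin 4) (Fin 4) ℝ → _) (h • hat x)).map_smul h
    (hat w)).symm.trans this

/-- After division by t > 0, let t tend to 0: the differential of the exponential is continuous and
equals the identity at 0. Using small t avoids the points where that differential may be singular.
-/
theorem hat_eq_zero_of_fderiv_exp {x w : Vec6} {l : ℝ} (hl : 0 < l)
    (h : ∀ t ∈ Set.Icc 0 l, t • fderiv ℝ (NormedSpace.exp : Matrix (Fin 4) (Fin 4) ℝ → _)
      (t • hat x) (hat w) = 0) : w = 0 := by
  have hc : Continuous fun t : ℝ => fderiv ℝ (NormedSpace.exp : Matrix (Fin 4) (Fin 4) ℝ → _)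
      (t • hat x) (hat w) :=
    ((contDiff_matrix_exp.continuous_fderiv one_ne_zero).comp (by fun_prop)).clm_apply
      continuous_const
  have h1 : Tendsto (fun t : ℝ => fderiv ℝ (NormedSpace.exp : Matrix (Fin 4) (Fin 4) ℝ → _)
      (t • hat x) (hat w)) (𝓝[>] 0) (𝓝 0) := by
    refine tendsto_const_nhds.congr' ?_
    filter_upwards [Ioc_mem_nhdsGT hl] with t ht
    exact ((smul_eq_zero.1 (h t ⟨ht.1.le, ht.2⟩)).resolve_left ht.1.ne').symm
  have h2 := tendsto_nhds_unique (hc.continuousWithinAt (s := Ioi 0) (x := 0)) h1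
  have h3 : fderiv ℝ (NormedSpace.exp : Matrix (Fin 4) (Fin 4) ℝ → _) 0 = 1 :=
    (hasFDerivAt_exp_zero (𝕂 := ℝ)).fderiv
  simp only [zero_smul, h3] at h2
  have h4 : hat w = 0 := h2
  ext i
  have := congrFun (congrArg vee h4) i
  revert this
  fin_cases i <;> simp [vee, hat]

/-- For each section, compare the pose at its left node with the pose a distance t further on: they
differ by a single exponential of that section's strain, which isolates the component of v there. -/
theorem eq_zero_of_chainJac (R : Robot N) (q v : Config N)
    (h : ∀ X ∈ Set.Icc 0 R.len, chainJac (fun i => R.arc i X) q *ᵥ v = 0) : v = 0 := by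
  have hchain : ∀ X ∈ Set.Icc 0 R.len, chainDeriv (fun i => R.arc i X) q v = 0 := by
    intro X hX
    have h1 := hat_chainJac_mulVec (fun i => R.arc i X) q v
    rw [h X hX, show hat 0 = 0 from hatₗ.map_zero] at h1
    exact ((Matrix.isUnit_nonsing_inv_iff.2 (isUnit_chain _ q)).mul_right_eq_zero).1 h1.symm
  suffices hw : ∀ i, (fun j => v (i, j)) = (0 : Vec6) by
    ext ⟨i, j⟩
    exact congrFun (hw i) j
  intro i
  have hlt : R.L i.castSucc < R.L i.succ := R.L_strictMono Fin.castSucc_lt_succ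
  have hnn : 0 ≤ R.L i.castSucc := R.L_zero ▸ R.L_strictMono.monotone (Fin.zero_le _)
  have hle : R.L i.succ ≤ R.len := R.L_strictMono.monotone (Fin.le_last _)
  refine hat_eq_zero_of_fderiv_exp (x := fun j => q (i, j)) (sub_pos.2 hlt) fun t ht => ?_
  have hmid : ∀ j, i ≤ j → R.arc j (R.L i.castSucc) = 0 := by
    intro j hj
    have : R.L i.castSucc ≤ R.L j.castSucc :=
      R.L_strictMono.monotone (Fin.castSucc_le_castSucc_iff.2 hj)
    refine max_eq_left ?_
    linarith [min_le_left (R.L i.castSucc) (R.L j.succ)]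
  refine exp_deriv_eq_zero_of_chain (fun j => R.arc j (R.L i.castSucc)) i hmid t q v
    (hchain _ ⟨hnn, hlt.le.trans hle⟩) ?_
  have hX := hchain (R.L i.castSucc + t) ⟨by linarith [ht.1], by linarith [ht.2]⟩
  -- At distance t past the left node of section i, earlier sections are still complete, section i
  -- has length t, and later ones have length 0.
  convert hX using 2
  funext j
  rcases lt_trichotomy j i with hj | rfl | hj
  · have h1 : R.L j.succ ≤ R.L i.castSucc := R.L_strictMono.monotone (by
      rw [Fin.le_def]; simpa using hj)
    rw [Function.update_of_ne hj.ne, Robot.arc, Robot.arc, min_eq_right h1,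
      min_eq_right (by linarith [ht.1])]
  · rw [Function.update_self, Robot.arc, min_eq_left (by linarith [ht.2]), add_sub_cancel_left,
      max_eq_right ht.1]
  · rw [Function.update_of_ne hj.ne', hmid j hj.le, Robot.arc, max_eq_left]
    have h1 : R.L i.succ ≤ R.L j.castSucc := R.L_strictMono.monotone (by
      rw [Fin.le_def]; simpa using hj)
    linarith [min_le_left (R.L i.castSucc + t) (R.L j.succ), ht.2]

end Smoothness

/-! ### Locally Lipschitz functions and integrals depending on a parameter. -/

section Calculus

open Set Filter MeasureTheory
open scoped Topology

theorem locallyLipschitz_mul {E : Type*} [PseudoEMetricSpace E] {f g : E → ℝ}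
    (hf : LocallyLipschitz f) (hg : LocallyLipschitz g) : LocallyLipschitz fun x => f x * g x :=
  (contDiff_mul (𝕜 := ℝ) (𝔸 := ℝ) (n := 1)).locallyLipschitz.comp (hf.prodMk hg)

theorem locallyLipschitz_sum {ι E F : Type*} [PseudoEMetricSpace E] [SeminormedAddCommGroup F]
    (s : Finset ι) {f : ι → E → F} (hf : ∀ i ∈ s, LocallyLipschitz (f i)) :
    LocallyLipschitz fun x => ∑ i ∈ s, f i x := by
  classical
  induction s using Finset.induction_on with
  | empty => simpa using LocallyLipschitz.const (0 : F)
  | insert i s hi ih =>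
    simp only [Finset.sum_insert hi]
    exact (hf i (Finset.mem_insert_self _ _)).add
      (ih fun j hj => hf j (Finset.mem_insert_of_mem hj))

theorem locallyLipschitz_pi {ι E F : Type*} [Fintype ι] [PseudoEMetricSpace E]
    [PseudoEMetricSpace F] {f : E → ι → F}
    (hf : ∀ i, LocallyLipschitz fun x => f x i) : LocallyLipschitz f := by
  intro x
  choose K t ht hK using fun i => hf i x
  refine ⟨∑ i, K i, ⋂ i, t i, Filter.iInter_mem.2 ht, fun y hy z hz => ?_⟩
  refine edist_pi_le_iff.2 fun i => (hK i (mem_iInter.1 hy i) (mem_iInter.1 hz i)).trans ?_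
  gcongr
  exact Finset.single_le_sum (f := K) (fun _ _ => zero_le) (Finset.mem_univ i)

theorem intervalIntegrable_finset_sum {ι : Type*} (s : Finset ι) {f : ι → ℝ → ℝ} {a b : ℝ}
    (hf : ∀ i ∈ s, IntervalIntegrable (f i) volume a b) :
    IntervalIntegrable (fun x => ∑ i ∈ s, f i x) volume a b := by
  simpa only [Finset.sum_fn] using IntervalIntegrable.sum s hf

theorem locallyLipschitz_comp_contDiffAt {E F G : Type*} [PseudoEMetricSpace E]
    [NormedAddCommGroup F] [NormedSpace ℝ F] [NormedAddCommGroup G] [NormedSpace ℝ G] {g : E → F}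
    {h : F → G} (hg : LocallyLipschitz g) (hh : ∀ x, ContDiffAt ℝ 1 h (g x)) :
    LocallyLipschitz fun x => h (g x) := by
  intro x
  obtain ⟨K, t, ht, hK⟩ := (hh x).exists_lipschitzOnWith
  obtain ⟨K', t', ht', hK'⟩ := hg x
  exact ⟨K * K', _, inter_mem ht' (hg.continuous.continuousAt ht),
    hK.comp (hK'.mono inter_subset_left) fun _ hy => hy.2⟩

variable {S P : Type*} [NormedAddCommGroup S] [NormedSpace ℝ S] [NormedAddCommGroup P]
  [NormedSpace ℝ P] [ProperSpace P]

/-- On the compact product of the curve and a ball, Φ has one Lipschitz constant C, and the integral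
inherits the constant ∫ |a| C. The weight a need only be integrable. -/
theorem locallyLipschitz_integral {S P : Type*} [PseudoMetricSpace S] [PseudoMetricSpace P]
    [ProperSpace P] {Φ : S × P → ℝ} (hΦ : LocallyLipschitz Φ) {s : ℝ → S} (hs : Continuous s)
    {a : ℝ → ℝ} {l : ℝ} (hl : 0 ≤ l) (ha : IntervalIntegrable a volume 0 l) :
    LocallyLipschitz fun p => ∫ X in (0 : ℝ)..l, a X * Φ (s X, p) := by
  intro p
  obtain ⟨C, hC⟩ := (hΦ.locallyLipschitzOn
    (s := (s '' Icc 0 l) ×ˢ Metric.closedBall p 1)).exists_lipschitzOnWith_of_compact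
    ((isCompact_Icc.image hs).prod (isCompact_closedBall p 1))
  have hint : ∀ p, IntervalIntegrable (fun X => a X * Φ (s X, p)) volume 0 l := fun p =>
    ha.mul_continuousOn (hΦ.continuous.comp (by fun_prop)).continuousOn
  refine ⟨(∫ X in (0 : ℝ)..l, |a X| * C).toNNReal, _, Metric.closedBall_mem_nhds p one_pos,
    LipschitzOnWith.of_dist_le_mul fun p₁ h₁ p₂ h₂ => ?_⟩
  have hnn : 0 ≤ ∫ X in (0 : ℝ)..l, |a X| * C :=
    intervalIntegral.integral_nonneg hl fun X _ => by positivity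
  rw [Real.coe_toNNReal _ hnn, Real.dist_eq, ← intervalIntegral.integral_sub (hint _) (hint _),
    ← intervalIntegral.integral_mul_const, ← Real.norm_eq_abs]
  refine intervalIntegral.norm_integral_le_of_norm_le hl (ae_of_all _ fun X hX => ?_)
    ((ha.abs.mul_const _).mul_const _)
  have hX' : s X ∈ s '' Icc 0 l := mem_image_of_mem _ (Ioc_subset_Icc_self hX)
  have := hC.dist_le_mul (s X, p₁) ⟨hX', h₁⟩ (s X, p₂) ⟨hX', h₂⟩
  rw [Prod.dist_eq, dist_self, max_eq_right dist_nonneg, Real.dist_eq] at this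
  rw [← mul_sub, norm_mul, Real.norm_eq_abs, Real.norm_eq_abs, mul_assoc]
  gcongr

/-- Dominated differentiation with majorant |a| C, where C bounds the partial derivative on a
compact product. -/
theorem hasFDerivAt_integral {Φ : S × P → ℝ} (hΦ : ContDiff ℝ 1 Φ) {s : ℝ → S}
    (hs : Continuous s) {a : ℝ → ℝ} {l : ℝ} (hl : 0 ≤ l) (ha : IntervalIntegrable a volume 0 l)
    (p : P) : ∃ L : P →L[ℝ] ℝ, HasFDerivAt (fun p => ∫ X in (0 : ℝ)..l, a X * Φ (s X, p)) L p ∧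
      ∀ w, L w = ∫ X in (0 : ℝ)..l, a X * lineDeriv ℝ (fun p => Φ (s X, p)) p w := by
  let Φ' : P → ℝ → P →L[ℝ] ℝ := fun p X =>
    (fderiv ℝ Φ (s X, p)).comp (ContinuousLinearMap.inr ℝ S P)
  have hΦ'c : Continuous fun z : P × ℝ => Φ' z.1 z.2 :=
    ((hΦ.continuous_fderiv one_ne_zero).comp (by fun_prop)).clm_comp continuous_const
  have hΦd : ∀ p X, HasFDerivAt (fun p => Φ (s X, p)) (Φ' p X) p := fun p X =>
    (hΦ.differentiable one_ne_zero (s X, p)).hasFDerivAt.comp p (hasFDerivAt_prodMk_right (s X) p)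
  obtain ⟨C, hC⟩ := ((isCompact_closedBall p 1).prod
    (isCompact_Icc (a := (0 : ℝ)) (b := l))).exists_bound_of_continuousOn hΦ'c.continuousOn
  have hint : ∀ p, IntervalIntegrable (fun X => a X * Φ (s X, p)) volume 0 l := fun p =>
    ha.mul_continuousOn (hΦ.continuous.comp (by fun_prop)).continuousOn
  have hint' : ∀ p, IntervalIntegrable (fun X => a X • Φ' p X) volume 0 l := fun p =>
    ha.smul_continuousOn (hΦ'c.comp (f := fun X : ℝ => (p, X)) (by fun_prop)).continuousOn
  have key := intervalIntegral.hasFDerivAt_integral_of_dominated_of_fderiv_le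
    (μ := volume) (a := 0) (b := l) (F := fun p X => a X * Φ (s X, p))
    (F' := fun p X => a X • Φ' p X) (x₀ := p) (bound := fun X => |a X| * C)
    (Metric.closedBall_mem_nhds p one_pos)
    (Eventually.of_forall fun p => (hint p).def'.aestronglyMeasurable) (hint p)
    (hint' p).def'.aestronglyMeasurable
    (ae_of_all _ fun X hX p' hp' => by
      rw [uIoc_of_le hl] at hX
      rw [norm_smul, Real.norm_eq_abs]
      exact mul_le_mul_of_nonneg_left (hC (p', X) ⟨hp', Ioc_subset_Icc_self hX⟩) (abs_nonneg _))
    (ha.abs.mul_const _)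
    (ae_of_all _ fun X _ p' _ => (hΦd p' X).const_mul (a X))
  refine ⟨_, key, fun w => ?_⟩
  rw [ContinuousLinearMap.intervalIntegral_apply (hint' p)]
  refine intervalIntegral.integral_congr fun X _ => ?_
  simp [((hΦd p X).hasLineDerivAt w).lineDeriv]

/-- The square root is not smooth at 0, but the function is a Euclidean norm after a linear
projection. -/
theorem locallyLipschitz_translationNorm : LocallyLipschitz translationNorm := by
  let T : Vec6 →ₗ[ℝ] EuclideanSpace ℝ (Fin 3) :=
    (WithLp.linearEquiv 2 ℝ (Fin 3 → ℝ)).symm.toLinearMap ∘ₗ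
      LinearMap.funLeft ℝ ℝ (![3, 4, 5] : Fin 3 → Fin 6)
  have h : translationNorm = fun x => ‖T x‖ := by
    funext x
    simp [translationNorm, EuclideanSpace.norm_eq, T, Fin.sum_univ_three, LinearMap.funLeft]
  rw [h]
  exact lipschitzWith_one_norm.locallyLipschitz.comp
    T.toContinuousLinearMap.lipschitz.locallyLipschitz

end Calculus

/-! ### Integrals of Aᵀ W B along the arm. -/

section Integrals

open Set Filter MeasureTheory
open scoped Topology

variable {N : ℕ} (R : Robot N)

theorem Robot.len_nonneg : 0 ≤ R.len := R.L_zero ▸ R.L_strictMono.monotone (Fin.zero_le _)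

/-- The lengths of the parts of all the sections that lie in `[0, X]`. -/
def Robot.arcs (X : ℝ) : Fin N → ℝ := fun i => R.arc i X

theorem Robot.continuous_arcs : Continuous R.arcs := by
  unfold Robot.arcs Robot.arc
  fun_prop

theorem Robot.integral_congr {m n : Type*} {A B : ℝ → Matrix m n ℝ}
    (h : ∀ X ∈ Icc 0 R.len, A X = B X) : R.integral A = R.integral B := by
  ext i j
  refine intervalIntegral.integral_congr fun X hX => ?_
  rw [uIcc_of_le R.len_nonneg] at hX
  simp only [h X hX]

theorem Robot.dotProduct_integral_mulVec {m n : Type*} [Fintype m] [Fintype n]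
    {A : ℝ → Matrix m n ℝ} (hA : ∀ i j, IntervalIntegrable (fun X => A X i j) volume 0 R.len)
    (x : m → ℝ) (y : n → ℝ) :
    x ⬝ᵥ (R.integral A *ᵥ y) = ∫ X in (0 : ℝ)..R.len, x ⬝ᵥ (A X *ᵥ y) := by
  simp only [Matrix.mulVec, dotProduct, Robot.integral, Matrix.of_apply]
  rw [intervalIntegral.integral_finsetSum fun i _ => IntervalIntegrable.const_mul
    (intervalIntegrable_finset_sum _ fun j _ => (hA i j).mul_const _) _]
  refine Finset.sum_congr rfl fun i _ => ?_
  rw [intervalIntegral.integral_const_mul,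
    intervalIntegral.integral_finsetSum fun j _ => (hA i j).mul_const _]
  simp only [intervalIntegral.integral_mul_const]

/-- The integral of `Aᵀ W B` along the robot, where `A` and `B` depend on the arc lengths. -/
def Robot.sandwich {m n : Type*} (W : ℝ → Matrix (Fin 6) (Fin 6) ℝ)
    (A : (Fin N → ℝ) → Matrix (Fin 6) m ℝ) (B : (Fin N → ℝ) → Matrix (Fin 6) n ℝ) :
    Matrix m n ℝ :=
  R.integral fun X => (A (R.arcs X))ᵀ * W X * B (R.arcs X)

/-- This separates the merely integrable entries of W from the regular factors, in the shape
required by the parameter integrals. -/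
theorem sandwich_entry {m n : Type*} (A : Matrix (Fin 6) m ℝ) (W : Matrix (Fin 6) (Fin 6) ℝ)
    (B : Matrix (Fin 6) n ℝ) (k : m) (l : n) :
    (Aᵀ * W * B) k l = ∑ j, ∑ i, W i j * (A i k * B j l) := by
  simp only [Matrix.mul_apply, Finset.sum_mul, Matrix.transpose_apply]
  refine Finset.sum_congr rfl fun j _ => Finset.sum_congr rfl fun i _ => ?_
  ring

variable {m n : Type*} {W : ℝ → Matrix (Fin 6) (Fin 6) ℝ}
  {A : (Fin N → ℝ) → Matrix (Fin 6) m ℝ} {B : (Fin N → ℝ) → Matrix (Fin 6) n ℝ}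

theorem Robot.intervalIntegrable_sandwich_term
    (hW : ∀ i j, IntervalIntegrable (fun X => W X i j) volume 0 R.len)
    (hA : ∀ i k, Continuous fun s => A s i k) (hB : ∀ i k, Continuous fun s => B s i k)
    (i j : Fin 6) (k : m) (l : n) : IntervalIntegrable
      (fun X => W X i j * (A (R.arcs X) i k * B (R.arcs X) j l)) volume 0 R.len :=
  (hW i j).mul_continuousOn (((hA i k).comp R.continuous_arcs).mul
    ((hB j l).comp R.continuous_arcs)).continuousOn

theorem Robot.sandwich_apply
    (hW : ∀ i j, IntervalIntegrable (fun X => W X i j) volume 0 R.len)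
    (hA : ∀ i k, Continuous fun s => A s i k) (hB : ∀ i k, Continuous fun s => B s i k)
    (k : m) (l : n) : R.sandwich W A B k l = ∑ j, ∑ i, ∫ X in (0 : ℝ)..R.len,
      W X i j * (A (R.arcs X) i k * B (R.arcs X) j l) := by
  have h := R.intervalIntegrable_sandwich_term hW hA hB
  simp only [Robot.sandwich, Robot.integral, Matrix.of_apply, sandwich_entry]
  rw [intervalIntegral.integral_finsetSum fun j _ =>
    intervalIntegrable_finset_sum _ fun i _ => h i j k l]
  exact Finset.sum_congr rfl fun j _ =>
    intervalIntegral.integral_finsetSum fun i _ => h i j k l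

theorem Robot.dotProduct_sandwich_mulVec [Fintype m] [Fintype n]
    (hW : ∀ i j, IntervalIntegrable (fun X => W X i j) volume 0 R.len)
    (hA : ∀ i k, Continuous fun s => A s i k) (hB : ∀ i k, Continuous fun s => B s i k)
    (x : m → ℝ) (y : n → ℝ) : x ⬝ᵥ (R.sandwich W A B *ᵥ y) =
      ∫ X in (0 : ℝ)..R.len, (A (R.arcs X) *ᵥ x) ⬝ᵥ (W X *ᵥ (B (R.arcs X) *ᵥ y)) := by
  rw [Robot.sandwich, R.dotProduct_integral_mulVec]
  · refine intervalIntegral.integral_congr fun X _ => ?_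
    simp only [← Matrix.mulVec_mulVec, Matrix.dotProduct_mulVec x, Matrix.vecMul_transpose]
  · intro k l
    simp only [sandwich_entry]
    exact intervalIntegrable_finset_sum _ fun j _ => intervalIntegrable_finset_sum _ fun i _ =>
      R.intervalIntegrable_sandwich_term hW hA hB i j k l

theorem Robot.locallyLipschitz_sandwich {P : Type*} [PseudoMetricSpace P] [ProperSpace P]
    {A : P → (Fin N → ℝ) → Matrix (Fin 6) m ℝ} {B : P → (Fin N → ℝ) → Matrix (Fin 6) n ℝ}
    (hW : ∀ i j, IntervalIntegrable (fun X => W X i j) volume 0 R.len)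
    (hA : ∀ i k, LocallyLipschitz fun z : (Fin N → ℝ) × P => A z.2 z.1 i k)
    (hB : ∀ i k, LocallyLipschitz fun z : (Fin N → ℝ) × P => B z.2 z.1 i k)
    (k : m) (l : n) : LocallyLipschitz fun p => R.sandwich W (A p) (B p) k l := by
  have hc : ∀ p : P, Continuous fun s : Fin N → ℝ => (s, p) := fun p => by fun_prop
  have h : ∀ p, R.sandwich W (A p) (B p) k l = _ := fun p => R.sandwich_apply hW
    (fun i k => (hA i k).continuous.comp (hc p)) (fun i k => (hB i k).continuous.comp (hc p)) k l
  simp only [h]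
  exact locallyLipschitz_sum _ fun j _ => locallyLipschitz_sum _ fun i _ =>
    locallyLipschitz_integral (locallyLipschitz_mul (hA i k) (hB j l)) R.continuous_arcs
      R.len_nonneg (hW i j)

end Integrals

/-! ### Regularity of M, C₁, C₂ and D, positivity of M, and the energy identities. -/

section RobotMatrices

open Set Filter MeasureTheory
open scoped Topology ContDiff

variable {N : ℕ} (R : Robot N)

theorem intervalIntegrable_mass (i j : Fin 6) :
    IntervalIntegrable (fun X => R.mass X i j) volume 0 R.len := by
  simp only [Robot.mass, Matrix.smul_apply, smul_eq_mul, Matrix.diagonal_apply]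
  refine IntervalIntegrable.const_mul ?_ _
  by_cases hij : i = j
  · simp only [hij, if_true]
    fin_cases j
    exacts [R.Ix_integrable, R.Iy_integrable, R.Iz_integrable, R.area_integrable,
      R.area_integrable, R.area_integrable]
  · simp [hij]

theorem intervalIntegrable_totalMass (i j : Fin 6) :
    IntervalIntegrable (fun X => R.totalMass X i j) volume 0 R.len :=
  (intervalIntegrable_mass R i j).add (R.addedMass_integrable i j)

theorem posDef_totalMass {X : ℝ} (hX : X ∈ Icc 0 R.len) : (R.totalMass X).PosDef := by
  refine Matrix.PosDef.add_posSemidef ?_ (R.addedMass_posSemidef X hX)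
  refine Matrix.PosDef.smul (Matrix.PosDef.diagonal fun i => ?_) R.ρ_pos
  fin_cases i
  exacts [R.Ix_pos X hX, R.Iy_pos X hX, R.Iz_pos X hX, R.area_pos X hX, R.area_pos X hX,
    R.area_pos X hX]

theorem transpose_totalMass {X : ℝ} (hX : X ∈ Icc 0 R.len) :
    (R.totalMass X)ᵀ = R.totalMass X := by
  simpa using (posDef_totalMass R hX).isHermitian.eq

theorem M_eq_sandwich (q : Config N) : R.M q =
    R.sandwich R.totalMass (fun s => chainJac s q) (fun s => chainJac s q) := rfl

theorem C₂_eq_sandwich (q v : Config N) : R.C₂ q v =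
    R.sandwich R.totalMass (fun s => chainJac s q) (fun s => chainJacDeriv s q v) := rfl

/-- The state-dependent coadjoint matrix is absorbed into the left factor, so that the weight
depends on X alone. -/
theorem C₁_eq_sandwich (q v : Config N) : R.C₁ q v = R.sandwich R.totalMass
    (fun s => (coad (chainJac s q *ᵥ v))ᵀ * chainJac s q) (fun s => chainJac s q) := by
  refine R.integral_congr fun X _ => ?_
  simp only [Matrix.transpose_mul, Matrix.transpose_transpose]
  rfl

theorem D_eq_sandwich (q v : Config N) : R.D q v = R.sandwich R.drag
    (fun s => translationNorm (chainJac s q *ᵥ v) • chainJac s q) (fun s => chainJac s q) := by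
  refine R.integral_congr fun X _ => ?_
  simp only [Matrix.transpose_smul, Matrix.smul_mul]
  rfl

theorem transpose_sandwich_totalMass {m n : Type*} (A : (Fin N → ℝ) → Matrix (Fin 6) m ℝ)
    (B : (Fin N → ℝ) → Matrix (Fin 6) n ℝ) :
    (R.sandwich R.totalMass A B)ᵀ = R.sandwich R.totalMass B A := by
  have h : (R.sandwich R.totalMass A B)ᵀ =
      R.integral fun X => ((A (R.arcs X))ᵀ * R.totalMass X * B (R.arcs X))ᵀ := rfl
  rw [h]
  refine R.integral_congr fun X hX => ?_
  rw [Matrix.transpose_mul, Matrix.transpose_mul, Matrix.transpose_transpose,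
    transpose_totalMass R hX, Matrix.mul_assoc]

theorem transpose_M (q : Config N) : (R.M q)ᵀ = R.M q := by
  rw [M_eq_sandwich, transpose_sandwich_totalMass]

/-! ### Regularity of the integrands -/

theorem locallyLipschitz_chainJac (i : Fin 6) (k : Fin N × Fin 6) :
    LocallyLipschitz fun p : (Fin N → ℝ) × Config N => chainJac p.1 p.2 i k :=
  ((contDiff_chainJac i k).of_le (by simp)).locallyLipschitz

theorem locallyLipschitz_chainJac' (i : Fin 6) (k : Fin N × Fin 6) :
    LocallyLipschitz fun p : (Fin N → ℝ) × Config N × Config N => chainJac p.1 p.2.1 i k :=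
  (((contDiff_chainJac i k).comp (f := fun p : (Fin N → ℝ) × Config N × Config N => (p.1, p.2.1))
    (by fun_prop)).of_le (by simp)).locallyLipschitz

theorem contDiff_chainJac_mulVec (i : Fin 6) : ContDiff ℝ ∞
    fun p : (Fin N → ℝ) × Config N × Config N => (chainJac p.1 p.2.1 *ᵥ p.2.2) i := by
  simp only [Matrix.mulVec, dotProduct]
  refine ContDiff.sum fun k _ => ContDiff.mul ?_ (by fun_prop)
  exact (contDiff_chainJac i k).comp
    (f := fun p : (Fin N → ℝ) × Config N × Config N => (p.1, p.2.1)) (by fun_prop)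

theorem locallyLipschitz_translationNorm_smul (i : Fin 6) (k : Fin N × Fin 6) :
    LocallyLipschitz fun p : (Fin N → ℝ) × Config N × Config N =>
      (translationNorm (chainJac p.1 p.2.1 *ᵥ p.2.2) • chainJac p.1 p.2.1) i k := by
  refine locallyLipschitz_mul ?_ (locallyLipschitz_chainJac' i k)
  exact locallyLipschitz_translationNorm.comp (locallyLipschitz_pi fun i =>
    ((contDiff_chainJac_mulVec i).of_le (by simp)).locallyLipschitz)

/-- `ad` as a linear map. -/
def adₗ (i j : Fin 6) : Vec6 →ₗ[ℝ] ℝ where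
  toFun x := ad x i j
  map_add' x y := by
    have h : hat (x + y) = hat x + hat y := hatₗ.map_add x y
    have h2 := veeₗ.map_add (hat x * hat (Pi.single j 1) - hat (Pi.single j 1) * hat x)
      (hat y * hat (Pi.single j 1) - hat (Pi.single j 1) * hat y)
    simp only [ad, Matrix.of_apply, h]
    rw [← Pi.add_apply]
    refine Eq.trans (congrArg (fun B => vee B i) ?_) (congrFun h2 i)
    noncomm_ring
  map_smul' c x := by
    have h : hat (c • x) = c • hat x := hatₗ.map_smul c x
    have h2 := veeₗ.map_smul c (hat x * hat (Pi.single j 1) - hat (Pi.single j 1) * hat x)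
    simp only [ad, Matrix.of_apply, h]
    refine Eq.trans (congrArg (fun B => vee B i) ?_) (congrFun h2 i)
    simp [smul_sub]

theorem locallyLipschitz_coad_mul (i : Fin 6) (k : Fin N × Fin 6) :
    LocallyLipschitz fun p : (Fin N → ℝ) × Config N × Config N =>
      ((coad (chainJac p.1 p.2.1 *ᵥ p.2.2))ᵀ * chainJac p.1 p.2.1) i k := by
  simp only [Matrix.mul_apply]
  refine locallyLipschitz_sum _ fun j _ => locallyLipschitz_mul ?_ (locallyLipschitz_chainJac' j k)
  have h : ContDiff ℝ ∞ fun p : (Fin N → ℝ) × Config N × Config N =>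
      -(adₗ i j).toContinuousLinearMap (chainJac p.1 p.2.1 *ᵥ p.2.2) :=
    ((adₗ i j).toContinuousLinearMap.contDiff.comp
      (contDiff_pi.2 contDiff_chainJac_mulVec)).neg
  exact (h.of_le (by simp)).locallyLipschitz

theorem locallyLipschitz_M (k l : Fin N × Fin 6) : LocallyLipschitz fun q => R.M q k l := by
  simp only [M_eq_sandwich]
  exact R.locallyLipschitz_sandwich (A := fun q s => chainJac s q) (B := fun q s => chainJac s q)
    (intervalIntegrable_totalMass R)
    locallyLipschitz_chainJac locallyLipschitz_chainJac k l

theorem locallyLipschitz_C₁ (k l : Fin N × Fin 6) :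
    LocallyLipschitz fun x : Config N × Config N => R.C₁ x.1 x.2 k l := by
  simp only [C₁_eq_sandwich]
  exact R.locallyLipschitz_sandwich (A := fun (x : Config N × Config N) s =>
      (coad (chainJac s x.1 *ᵥ x.2))ᵀ * chainJac s x.1)
    (B := fun (x : Config N × Config N) s => chainJac s x.1) (intervalIntegrable_totalMass R)
    locallyLipschitz_coad_mul locallyLipschitz_chainJac' k l

theorem locallyLipschitz_C₂ (k l : Fin N × Fin 6) :
    LocallyLipschitz fun x : Config N × Config N => R.C₂ x.1 x.2 k l := by
  simp only [C₂_eq_sandwich]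
  exact R.locallyLipschitz_sandwich (A := fun (x : Config N × Config N) s => chainJac s x.1)
    (B := fun (x : Config N × Config N) s => chainJacDeriv s x.1 x.2) (intervalIntegrable_totalMass R)
    locallyLipschitz_chainJac'
    (fun i k => ((contDiff_chainJacDeriv i k).of_le (by simp)).locallyLipschitz) k l

theorem locallyLipschitz_D (k l : Fin N × Fin 6) :
    LocallyLipschitz fun x : Config N × Config N => R.D x.1 x.2 k l := by
  simp only [D_eq_sandwich]
  exact R.locallyLipschitz_sandwich (A := fun (x : Config N × Config N) s =>
      translationNorm (chainJac s x.1 *ᵥ x.2) • chainJac s x.1)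
    (B := fun (x : Config N × Config N) s => chainJac s x.1) R.drag_integrable
    locallyLipschitz_translationNorm_smul locallyLipschitz_chainJac' k l

/-! ### Energy identities -/

theorem continuous_chainJac (q : Config N) (i : Fin 6) (k : Fin N × Fin 6) :
    Continuous fun s => chainJac s q i k :=
  (locallyLipschitz_chainJac i k).continuous.comp (f := fun s : Fin N → ℝ => (s, q))
    (by fun_prop)

/-- The form is the integral of a density that is positive wherever J v ≠ 0. If the integral
vanishes, J v = 0 almost everywhere, hence everywhere on the arm by continuity, and injectivity
gives v = 0. -/
theorem posDef_M (q : Config N) : (R.M q).PosDef := by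
  refine Matrix.PosDef.of_dotProduct_mulVec_pos (by simpa [Matrix.IsHermitian] using transpose_M R q) fun v hv => ?_
  rw [star_trivial, M_eq_sandwich, R.dotProduct_sandwich_mulVec (intervalIntegrable_totalMass R)
    (continuous_chainJac q) (continuous_chainJac q)]
  set w : ℝ → Vec6 := fun X => chainJac (R.arcs X) q *ᵥ v with hw
  have hwc : Continuous w := continuous_pi fun i => by
    simp only [hw, Matrix.mulVec, dotProduct]
    exact continuous_finsetSum _ fun k _ =>
      ((continuous_chainJac q i k).comp R.continuous_arcs).mul continuous_const
  have hint : IntervalIntegrable (fun X => w X ⬝ᵥ (R.totalMass X *ᵥ w X)) volume 0 R.len := by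
    simp only [Matrix.mulVec, dotProduct, Finset.mul_sum]
    refine intervalIntegrable_finset_sum _ fun i _ => intervalIntegrable_finset_sum _ fun j _ => ?_
    have := (intervalIntegrable_totalMass R i j).mul_continuousOn (g := fun X => w X j * w X i)
      (by fun_prop)
    refine this.congr fun X _ => ?_
    ring
  have hpos : ∀ X ∈ Icc 0 R.len, w X ≠ 0 → 0 < w X ⬝ᵥ (R.totalMass X *ᵥ w X) := fun X hX h => by
    simpa using (posDef_totalMass R hX).dotProduct_mulVec_pos h
  have hnonneg : ∀ X ∈ Icc 0 R.len, 0 ≤ w X ⬝ᵥ (R.totalMass X *ᵥ w X) := fun X hX => by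
    simpa using (posDef_totalMass R hX).posSemidef.dotProduct_mulVec_nonneg (w X)
  refine (intervalIntegral.integral_nonneg R.len_nonneg hnonneg).lt_of_ne' fun h0 => hv ?_
  have hae := (intervalIntegral.integral_eq_zero_iff_of_le_of_nonneg_ae R.len_nonneg
    ((ae_restrict_iff' measurableSet_Ioc).2 (ae_of_all _ fun X hX =>
      hnonneg X (Ioc_subset_Icc_self hX))) hint).1 h0
  -- A nonzero v has an index, so there is at least one section and the arm has positive length.
  have hlen : (0 : ℝ) ≠ R.len := by
    obtain ⟨k, -⟩ := Function.ne_iff.1 hv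
    have : R.L 0 < R.L (Fin.last N) := R.L_strictMono (Fin.pos_iff_ne_zero.2 fun h => by
      have := k.1.pos
      simp [Fin.ext_iff] at h
      omega)
    rw [R.L_zero] at this
    exact this.ne
  have hw0 : w =ᵐ[volume.restrict (Icc 0 R.len)] 0 := by
    rw [← restrict_Ioc_eq_restrict_Icc]
    filter_upwards [hae, ae_restrict_mem measurableSet_Ioc] with X hX hX'
    by_contra h
    exact (hpos X (Ioc_subset_Icc_self hX') h).ne' hX
  exact eq_zero_of_chainJac R q v
    (Measure.eqOn_Icc_of_ae_eq volume hlen hw0 hwc.continuousOn continuousOn_const)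

theorem ad_mulVec_self (x : Vec6) : ad x *ᵥ x = 0 := by
  ext i
  fin_cases i <;>
    simp [ad, hat, vee, Matrix.mulVec, dotProduct, Fin.sum_univ_succ, Pi.single_apply] <;> ring


/-- Transposed to the left, the coadjoint matrix of η = J v acts as -ad_η on η itself, so the
integrand is zero pointwise. -/
theorem dotProduct_C₁_mulVec (q v : Config N) : v ⬝ᵥ (R.C₁ q v *ᵥ v) = 0 := by
  have hc : Continuous fun s : Fin N → ℝ => (s, q, v) := by fun_prop
  have hA : ∀ i k, Continuous fun s : Fin N → ℝ =>
      ((coad (chainJac s q *ᵥ v))ᵀ * chainJac s q) i k := fun i k => by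
    have h := (locallyLipschitz_coad_mul (N := N) i k).continuous.comp hc
    exact h
  rw [C₁_eq_sandwich, R.dotProduct_sandwich_mulVec
    (A := fun s => (coad (chainJac s q *ᵥ v))ᵀ * chainJac s q) (intervalIntegrable_totalMass R)
    hA (continuous_chainJac q)]
  refine (intervalIntegral.integral_congr fun X _ => ?_).trans intervalIntegral.integral_zero
  simp only [← Matrix.mulVec_mulVec, coad, Matrix.transpose_neg, Matrix.transpose_transpose,
    Matrix.neg_mulVec, ad_mulVec_self, neg_zero, zero_dotProduct]

theorem dotProduct_D_mulVec_nonneg (q v : Config N) : 0 ≤ v ⬝ᵥ (R.D q v *ᵥ v) := by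
  have hc : Continuous fun s : Fin N → ℝ => (s, q, v) := by fun_prop
  have hA : ∀ i k, Continuous fun s : Fin N → ℝ =>
      (translationNorm (chainJac s q *ᵥ v) • chainJac s q) i k := fun i k => by
    have h := (locallyLipschitz_translationNorm_smul (N := N) i k).continuous.comp hc
    exact h
  rw [D_eq_sandwich, R.dotProduct_sandwich_mulVec
    (A := fun s => translationNorm (chainJac s q *ᵥ v) • chainJac s q) R.drag_integrable
    hA (continuous_chainJac q)]
  refine intervalIntegral.integral_nonneg R.len_nonneg fun X hX => ?_
  rw [Matrix.smul_mulVec, smul_dotProduct, smul_eq_mul]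
  exact mul_nonneg (Real.sqrt_nonneg _) (R.drag_nonneg X hX _)

/-- Product rule under the integral: differentiating the right Jacobian gives C₂, and
differentiating the left one gives its transpose, by symmetry of the total mass. -/
theorem hasFDerivAt_M (q : Config N) (k l : Fin N × Fin 6) : ∃ L : Config N →L[ℝ] ℝ,
    HasFDerivAt (fun q => R.M q k l) L q ∧ ∀ v, L v = (R.C₂ q v + (R.C₂ q v)ᵀ) k l := by
  have hΦ : ∀ i j, ContDiff ℝ ∞ fun p : (Fin N → ℝ) × Config N =>
      chainJac p.1 p.2 i k * chainJac p.1 p.2 j l :=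
    fun i j => (contDiff_chainJac i k).mul (contDiff_chainJac j l)
  choose L hL hLv using fun i j => hasFDerivAt_integral ((hΦ i j).of_le (by simp))
    R.continuous_arcs R.len_nonneg (intervalIntegrable_totalMass R i j) q
  refine ⟨∑ j, ∑ i, L i j, ?_, fun v => ?_⟩
  · have h : (fun q => R.M q k l) = fun q => ∑ j, ∑ i, ∫ X in (0 : ℝ)..R.len, R.totalMass X i j *
        (chainJac (R.arcs X) q i k * chainJac (R.arcs X) q j l) := by
      funext q
      rw [M_eq_sandwich, R.sandwich_apply (intervalIntegrable_totalMass R)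
        (continuous_chainJac q) (continuous_chainJac q)]
    rw [h]
    exact HasFDerivAt.fun_sum fun j _ => HasFDerivAt.fun_sum fun i _ => hL i j
  · have hd : ∀ s i k, HasLineDerivAt ℝ (fun q => chainJac s q i k) (chainJacDeriv s q v i k) q v :=
      fun s i k => by
        have h : Differentiable ℝ fun q => chainJac s q i k :=
          ((contDiff_chainJac i k).comp (f := fun q : Config N => (s, q))
            (by fun_prop)).differentiable (by simp)
        exact (h q).lineDifferentiableAt.hasLineDerivAt
    have hc : ∀ i k, Continuous fun s => chainJacDeriv s q v i k := fun i k =>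
      (contDiff_chainJacDeriv i k).continuous.comp (f := fun s : Fin N → ℝ => (s, q, v))
        (by fun_prop)
    rw [C₂_eq_sandwich, transpose_sandwich_totalMass, Matrix.add_apply,
      R.sandwich_apply (intervalIntegrable_totalMass R) (continuous_chainJac q) hc,
      R.sandwich_apply (intervalIntegrable_totalMass R) hc (continuous_chainJac q),
      _root_.sum_apply, ← Finset.sum_add_distrib]
    refine Finset.sum_congr rfl fun j _ => ?_
    rw [_root_.sum_apply, ← Finset.sum_add_distrib]
    refine Finset.sum_congr rfl fun i _ => ?_
    rw [hLv, ← intervalIntegral.integral_add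
      (R.intervalIntegrable_sandwich_term (intervalIntegrable_totalMass R)
        (continuous_chainJac q) hc i j k l)
      (R.intervalIntegrable_sandwich_term (intervalIntegrable_totalMass R)
        hc (continuous_chainJac q) i j k l)]
    refine intervalIntegral.integral_congr fun X _ => ?_
    have hprod : HasLineDerivAt ℝ (fun q => chainJac (R.arcs X) q i k * chainJac (R.arcs X) q j l)
        (chainJacDeriv (R.arcs X) q v i k * chainJac (R.arcs X) q j l +
          chainJac (R.arcs X) q i k * chainJacDeriv (R.arcs X) q v j l) q v := by
      have := HasDerivAt.fun_mul (hd (R.arcs X) i k) (hd (R.arcs X) j l)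
      simp only [zero_smul, add_zero] at this
      exact this
    simp only [hprod.lineDeriv]
    ring

end RobotMatrices

/-! ### Quantitative bounds, derivatives and regularity for matrix expressions. -/

section QuadraticForms

open Set Filter
open scoped Topology

variable {ι : Type*} [Fintype ι]

theorem norm_le_sqrt_dotProduct (x : ι → ℝ) : ‖x‖ ≤ √(x ⬝ᵥ x) := by
  refine (pi_norm_le_iff_of_nonneg (Real.sqrt_nonneg _)).2 fun i => Real.le_sqrt_of_sq_le ?_
  rw [Real.norm_eq_abs, sq_abs, sq]
  exact Finset.single_le_sum (f := fun i => x i * x i) (fun i _ => mul_self_nonneg _)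
    (Finset.mem_univ i)

/-- The sum of the absolute values of the entries of a matrix. -/
def entrySum (A : Matrix ι ι ℝ) : ℝ := ∑ k, ∑ l, |A k l|

/-- Young's inequality entry by entry; δ stays free so that one of the two squares can later be
absorbed. -/
theorem abs_dotProduct_mulVec_le (A : Matrix ι ι ℝ) (x y : ι → ℝ) {δ : ℝ} (hδ : 0 < δ) :
    |x ⬝ᵥ (A *ᵥ y)| ≤ entrySum A * (δ * (x ⬝ᵥ x) + (y ⬝ᵥ y) / (4 * δ)) := by
  simp only [Matrix.mulVec, dotProduct, entrySum, Finset.mul_sum, Finset.sum_mul]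
  refine (Finset.abs_sum_le_sum_abs _ _).trans (Finset.sum_le_sum fun k _ => ?_)
  refine (Finset.abs_sum_le_sum_abs _ _).trans (Finset.sum_le_sum fun l _ => ?_)
  have hx : x k * x k ≤ ∑ i, x i * x i := Finset.single_le_sum (f := fun i => x i * x i)
    (fun i _ => mul_self_nonneg _) (Finset.mem_univ k)
  have hy : y l * y l ≤ ∑ i, y i * y i := Finset.single_le_sum (f := fun i => y i * y i)
    (fun i _ => mul_self_nonneg _) (Finset.mem_univ l)
  rw [← Finset.mul_sum, abs_mul, abs_mul, mul_left_comm]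
  refine mul_le_mul_of_nonneg_left ?_ (abs_nonneg _)
  calc |x k| * |y l| ≤ δ * (x k * x k) + (y l * y l) / (4 * δ) := by
        rw [← abs_mul_abs_self (x k), ← abs_mul_abs_self (y l), ← sub_nonneg]
        have : δ * (|x k| * |x k|) + |y l| * |y l| / (4 * δ) - |x k| * |y l| =
            (2 * δ * |x k| - |y l|) ^ 2 / (4 * δ) := by
          field_simp
          ring
        rw [this]
        positivity
    _ ≤ _ := by gcongr

theorem dotProduct_mulVec_comm_of_transpose_eq {A : Matrix ι ι ℝ} (hA : Aᵀ = A) (x y : ι → ℝ) :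
    x ⬝ᵥ (A *ᵥ y) = y ⬝ᵥ (A *ᵥ x) := by
  rw [Matrix.dotProduct_mulVec, ← Matrix.mulVec_transpose, hA, dotProduct_comm]

/-- The form attains a positive minimum on the product of K with the unit sphere, and homogeneity of
degree two extends the bound to all vectors. -/
theorem exists_pos_forall_mul_le_dotProduct {P : Type*} [TopologicalSpace P] {K : Set P}
    (hK : IsCompact K) {A : P → Matrix ι ι ℝ} (hA : ∀ k l, Continuous fun p => A p k l)
    (hpos : ∀ p, (A p).PosDef) :
    ∃ m > 0, ∀ p ∈ K, ∀ w, m * (w ⬝ᵥ w) ≤ w ⬝ᵥ (A p *ᵥ w) := by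
  have hdc : Continuous fun w : ι → ℝ => w ⬝ᵥ w := by unfold dotProduct; fun_prop
  have hS : IsCompact {w : ι → ℝ | w ⬝ᵥ w = 1} := by
    refine Metric.isCompact_of_isClosed_isBounded (isClosed_eq hdc continuous_const) ?_
    refine Metric.isBounded_closedBall (x := 0) (r := 1) |>.subset fun w hw => ?_
    have := norm_le_sqrt_dotProduct w
    rw [show w ⬝ᵥ w = 1 from hw, Real.sqrt_one] at this
    simpa using this
  have hform : Continuous fun z : P × (ι → ℝ) => z.2 ⬝ᵥ (A z.1 *ᵥ z.2) := by
    simp only [Matrix.mulVec, dotProduct]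
    exact continuous_finsetSum _ fun k _ => Continuous.mul (by fun_prop) <|
      continuous_finsetSum _ fun l _ => ((hA k l).comp continuous_fst).mul (by fun_prop)
  have hne : ∀ w : ι → ℝ, w ⬝ᵥ w = 1 → w ≠ 0 := by
    rintro w hw rfl
    simp at hw
  have hm : ∃ m > 0, ∀ p ∈ K, ∀ w : ι → ℝ, w ⬝ᵥ w = 1 → m ≤ w ⬝ᵥ (A p *ᵥ w) := by
    rcases eq_empty_or_nonempty (K ×ˢ {w : ι → ℝ | w ⬝ᵥ w = 1}) with h | h
    · exact ⟨1, one_pos, fun p hp w hw => absurd (h.subset ⟨hp, hw⟩ : (p, w) ∈ ∅) (by simp)⟩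
    · obtain ⟨z, hz, hmin⟩ := (hK.prod hS).exists_isMinOn h hform.continuousOn
      refine ⟨_, ?_, fun p hp w hw => hmin (a := (p, w)) ⟨hp, hw⟩⟩
      simpa using (hpos z.1).dotProduct_mulVec_pos (hne _ hz.2)
  obtain ⟨m, hm0, hm⟩ := hm
  refine ⟨m, hm0, fun p hp w => ?_⟩
  rcases eq_or_ne w 0 with rfl | hw
  · simp
  have hww : 0 < w ⬝ᵥ w := by simpa using Matrix.dotProduct_star_self_pos_iff.2 hw
  have hr : √(w ⬝ᵥ w) * √(w ⬝ᵥ w) = w ⬝ᵥ w := Real.mul_self_sqrt hww.le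
  have hr0 : 0 < √(w ⬝ᵥ w) := Real.sqrt_pos.2 hww
  have h1 := hm p hp ((√(w ⬝ᵥ w))⁻¹ • w) (by
    rw [smul_dotProduct, dotProduct_smul, smul_eq_mul, smul_eq_mul, ← mul_assoc, ← mul_inv, hr,
      inv_mul_cancel₀ hww.ne'])
  rw [smul_dotProduct, Matrix.mulVec_smul, dotProduct_smul, smul_eq_mul, smul_eq_mul, ← mul_assoc,
    ← mul_inv, hr, inv_mul_eq_div, le_div_iff₀ hww] at h1
  exact h1

theorem hasDerivWithinAt_dotProduct_mulVec {x y : ℝ → ι → ℝ} {A : ℝ → Matrix ι ι ℝ}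
    {x' y' : ι → ℝ} {A' : Matrix ι ι ℝ} {s : Set ℝ} {t : ℝ} (hx : HasDerivWithinAt x x' s t)
    (hA : ∀ k l, HasDerivWithinAt (fun τ => A τ k l) (A' k l) s t)
    (hy : HasDerivWithinAt y y' s t) :
    HasDerivWithinAt (fun τ => x τ ⬝ᵥ (A τ *ᵥ y τ))
      (x' ⬝ᵥ (A t *ᵥ y t) + x t ⬝ᵥ (A' *ᵥ y t) + x t ⬝ᵥ (A t *ᵥ y')) s t := by
  have hx' := hasDerivWithinAt_pi.1 hx
  have hy' := hasDerivWithinAt_pi.1 hy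
  have h := HasDerivWithinAt.fun_sum (u := Finset.univ) fun k _ => (hx' k).fun_mul
    (HasDerivWithinAt.fun_sum (u := Finset.univ) fun l _ => (hA k l).fun_mul (hy' l))
  refine h.congr_deriv ?_
  simp only [Matrix.mulVec, dotProduct, ← Finset.sum_add_distrib]
  refine Finset.sum_congr rfl fun k _ => ?_
  rw [Finset.sum_add_distrib]
  ring

theorem locallyLipschitz_mulVec {E : Type*} [PseudoEMetricSpace E] {A : E → Matrix ι ι ℝ}
    {y : E → ι → ℝ} (hA : ∀ k l, LocallyLipschitz fun x => A x k l)
    (hy : ∀ l, LocallyLipschitz fun x => y x l) (k : ι) :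
    LocallyLipschitz fun x => (A x *ᵥ y x) k :=
  locallyLipschitz_sum _ fun l _ => locallyLipschitz_mul (hA k l) (hy l)

/-- Inversion in a Banach algebra is smooth at every unit. -/
theorem locallyLipschitz_inv {E : Type*} [PseudoEMetricSpace E] [DecidableEq ι]
    {A : E → Matrix ι ι ℝ} (hA : ∀ k l, LocallyLipschitz fun x => A x k l)
    (hu : ∀ x, IsUnit (A x)) (k l : ι) : LocallyLipschitz fun x => (A x)⁻¹ k l := by
  have hg : LocallyLipschitz (fun x i j => A x i j : E → ι → ι → ℝ) :=
    locallyLipschitz_pi fun i => locallyLipschitz_pi fun j => hA i j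
  have hh : ∀ x, ContDiffAt ℝ 1 (fun B : ι → ι → ℝ => (Matrix.of B)⁻¹ k l) (fun i j => A x i j) := by
    intro x
    open scoped Matrix.Norms.Operator in
    simp only [Matrix.nonsing_inv_eq_ringInverse]
    obtain ⟨u, hu⟩ := hu x
    have h : ContDiffAt ℝ 1 Ring.inverse (Matrix.of fun i j => A x i j) := by
      rw [show (Matrix.of fun i j => A x i j) = u from hu.symm]
      exact contDiffAt_ringInverse ℝ u
    have hof : ContDiff ℝ 1 fun B : ι → ι → ℝ => Matrix.of B :=
      (Matrix.ofLinearEquiv ℝ : (ι → ι → ℝ) ≃ₗ[ℝ] Matrix ι ι ℝ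
        ).toLinearMap.toContinuousLinearMap.contDiff
    exact (contDiff_entry k l).contDiffAt.comp _ (h.comp _ hof.contDiffAt)
  exact locallyLipschitz_comp_contDiffAt hg hh

end QuadraticForms

/-! ### The closed loop, its energy, and the strict Lyapunov function. -/

section ClosedLoop

open Set Filter
open scoped Topology

variable {N : ℕ} (R : Robot N) (Kp Kd : Matrix (Fin N × Fin 6) (Fin N × Fin 6) ℝ) (qd : Config N)

/-- The generalized force `M(q) q̈` in the closed loop without cable and gravity. -/
def netForce (q v : Config N) : Config N :=
  pdLaw Kp Kd qd q v - R.D q v *ᵥ v - (R.C₁ q v + R.C₂ q v) *ᵥ v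

/-- The vector field of the closed loop without cable and gravity. -/
def closedLoopField (x : Config N × Config N) : Config N × Config N :=
  (x.2, (R.M x.1)⁻¹ *ᵥ netForce R Kp Kd qd x.1 x.2)

theorem isUnit_M (q : Config N) : IsUnit (R.M q) := (posDef_M R q).isUnit

theorem M_mulVec_closedLoopField (x : Config N × Config N) :
    R.M x.1 *ᵥ (closedLoopField R Kp Kd qd x).2 = netForce R Kp Kd qd x.1 x.2 := by
  rw [closedLoopField, Matrix.mulVec_mulVec,
    Matrix.mul_nonsing_inv _ ((Matrix.isUnit_iff_isUnit_det _).1 (isUnit_M R x.1)),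
    Matrix.one_mulVec]

variable {R} in
theorem F_eq_zero (hcable : R.cable = none) (q : Config N) : R.F q = 0 := by
  simp [Robot.F, hcable]

variable {R} in
-- Invertibility of M turns the implicit equation of motion into an ordinary differential equation.
theorem closedLoop_iff (hcable : R.cable = none) (hgrav : ∀ q, R.gravForce q = 0)
    (x x' : Config N × Config N) :
    R.ClosedLoop (pdLaw Kp Kd qd) x x' ↔ x' = closedLoopField R Kp Kd qd x := by
  have hdet := (Matrix.isUnit_iff_isUnit_det _).1 (isUnit_M R x.1)
  have h : R.EquationOfMotion x.1 x.2 x'.2 (pdLaw Kp Kd qd x.1 x.2) ↔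
      R.M x.1 *ᵥ x'.2 = netForce R Kp Kd qd x.1 x.2 := by
    rw [Robot.EquationOfMotion, F_eq_zero hcable, hgrav, add_zero, add_zero, netForce]
    exact eq_sub_iff_add_eq.symm
  rw [Robot.ClosedLoop, h, Prod.ext_iff]
  refine and_congr_right fun _ => ⟨fun h => ?_, fun h => ?_⟩
  · rw [closedLoopField, ← h, Matrix.mulVec_mulVec, Matrix.nonsing_inv_mul _ hdet,
      Matrix.one_mulVec]
  · rw [h, M_mulVec_closedLoopField]

theorem locallyLipschitz_closedLoopField : LocallyLipschitz (closedLoopField R Kp Kd qd) := by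
  have hfst : ∀ l, LocallyLipschitz fun x : Config N × Config N => (x.1 - qd) l := fun l =>
    ContDiff.locallyLipschitz (𝕂 := ℝ) (by simp only [Pi.sub_apply]; fun_prop)
  have hsnd : ∀ l, LocallyLipschitz fun x : Config N × Config N => x.2 l := fun l =>
    ContDiff.locallyLipschitz (𝕂 := ℝ) (by fun_prop)
  have hforce : ∀ k, LocallyLipschitz fun x : Config N × Config N =>
      netForce R Kp Kd qd x.1 x.2 k := by
    intro k
    simp only [netForce, pdLaw, Pi.sub_apply, Pi.neg_apply]
    refine LocallyLipschitz.sub (LocallyLipschitz.sub (LocallyLipschitz.sub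
      (LocallyLipschitz.neg ?_) ?_) ?_) ?_
    · exact locallyLipschitz_mulVec (A := fun _ => Kp) (fun _ _ => LocallyLipschitz.const _) hfst k
    · exact locallyLipschitz_mulVec (A := fun _ => Kd) (fun _ _ => LocallyLipschitz.const _) hsnd k
    · exact locallyLipschitz_mulVec (A := fun x : Config N × Config N => R.D x.1 x.2)
        (locallyLipschitz_D R) hsnd k
    · exact locallyLipschitz_mulVec
        (A := fun x : Config N × Config N => R.C₁ x.1 x.2 + R.C₂ x.1 x.2)
        (fun i j => (locallyLipschitz_C₁ R i j).add (locallyLipschitz_C₂ R i j)) hsnd k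
  have hM : ∀ k l, LocallyLipschitz fun x : Config N × Config N => R.M x.1 k l := fun k l =>
    (locallyLipschitz_M R k l).comp LipschitzWith.prod_fst.locallyLipschitz
  exact LipschitzWith.prod_snd.locallyLipschitz.prodMk (locallyLipschitz_pi fun k =>
    locallyLipschitz_mulVec (A := fun x : Config N × Config N => (R.M x.1)⁻¹) (locallyLipschitz_inv hM fun x => isUnit_M R x.1) hforce k)

/-- The total energy of the robot and of the virtual spring of stiffness `Kp`. -/
def energy (x : Config N × Config N) : ℝ :=
  2⁻¹ * (x.2 ⬝ᵥ (R.M x.1 *ᵥ x.2)) + 2⁻¹ * ((x.1 - qd) ⬝ᵥ (Kp *ᵥ (x.1 - qd)))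

/-- The power dissipated by the drag and by the virtual damper, with a negative sign. -/
def power (x : Config N × Config N) : ℝ :=
  -(x.2 ⬝ᵥ (Kd *ᵥ x.2)) - x.2 ⬝ᵥ (R.D x.1 x.2 *ᵥ x.2)

/-- The product of the position error and the generalized momentum. -/
def crossTerm (x : Config N × Config N) : ℝ := (x.1 - qd) ⬝ᵥ (R.M x.1 *ᵥ x.2)

/-- The matrix that couples position error and velocity in the derivative of `crossTerm`. -/
def couplingMatrix (x : Config N × Config N) : Matrix (Fin N × Fin 6) (Fin N × Fin 6) ℝ :=
  (R.C₂ x.1 x.2)ᵀ - R.C₁ x.1 x.2 - R.D x.1 x.2 - Kd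

/-- The derivative of `crossTerm` along the closed loop. -/
def crossTermDeriv (x : Config N × Config N) : ℝ :=
  x.2 ⬝ᵥ (R.M x.1 *ᵥ x.2) - (x.1 - qd) ⬝ᵥ (Kp *ᵥ (x.1 - qd)) +
    (x.1 - qd) ⬝ᵥ (couplingMatrix R Kd x *ᵥ x.2)

section Derivatives

variable {x : ℝ → Config N × Config N} {s : Set ℝ}
  {t : ℝ} {x' : Config N × Config N}

theorem hasDerivWithinAt_fst (hx : HasDerivWithinAt x x' s t) :
    HasDerivWithinAt (fun τ => (x τ).1) x'.1 s t :=
  (ContinuousLinearMap.fst ℝ (Config N) (Config N)).hasFDerivAt.comp_hasDerivWithinAt t hx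

theorem hasDerivWithinAt_snd (hx : HasDerivWithinAt x x' s t) :
    HasDerivWithinAt (fun τ => (x τ).2) x'.2 s t :=
  (ContinuousLinearMap.snd ℝ (Config N) (Config N)).hasFDerivAt.comp_hasDerivWithinAt t hx

theorem hasDerivWithinAt_M {q : ℝ → Config N} {v : Config N} (hq : HasDerivWithinAt q v s t)
    (k l : Fin N × Fin 6) : HasDerivWithinAt (fun τ => R.M (q τ) k l)
      ((R.C₂ (q t) v + (R.C₂ (q t) v)ᵀ) k l) s t := by
  obtain ⟨L, hL, hLv⟩ := hasFDerivAt_M R (q t) k l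
  rw [← hLv]
  exact hL.comp_hasDerivWithinAt t hq

end Derivatives

theorem dotProduct_netForce (w q v : Config N) : w ⬝ᵥ netForce R Kp Kd qd q v =
    -(w ⬝ᵥ (Kp *ᵥ (q - qd))) - w ⬝ᵥ (Kd *ᵥ v) - w ⬝ᵥ (R.D q v *ᵥ v) -
      (w ⬝ᵥ (R.C₁ q v *ᵥ v) + w ⬝ᵥ (R.C₂ q v *ᵥ v)) := by
  simp only [netForce, pdLaw, dotProduct_sub, dotProduct_neg, Matrix.add_mulVec, dotProduct_add]

/-- Half of C₂ + C₂ᵀ has the same quadratic form as C₂ and cancels the Coriolis term in the force;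
C₁ does no work, and the spring force cancels the change of spring energy. -/
theorem hasDerivAlong_energy (hKp : Kpᵀ = Kp) :
    HasDerivAlong (closedLoopField R Kp Kd qd) (energy R Kp qd) (power R Kd) := by
  intro x s t hx
  have hq := hasDerivWithinAt_fst hx
  have hv := hasDerivWithinAt_snd hx
  have h1 := (hasDerivWithinAt_dotProduct_mulVec hv (hasDerivWithinAt_M R hq) hv).const_mul 2⁻¹
  have h2 := (hasDerivWithinAt_dotProduct_mulVec (hq.sub_const qd) (A := fun _ => Kp) (A' := 0)
    (fun k l => hasDerivWithinAt_const _ _ _) (hq.sub_const qd)).const_mul 2⁻¹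
  refine (h1.add h2).congr_deriv ?_
  have e1 := dotProduct_mulVec_comm_of_transpose_eq (transpose_M R (x t).1)
    (closedLoopField R Kp Kd qd (x t)).2 (x t).2
  have e2 : (x t).2 ⬝ᵥ ((R.C₂ (x t).1 (x t).2)ᵀ *ᵥ (x t).2) =
      (x t).2 ⬝ᵥ (R.C₂ (x t).1 (x t).2 *ᵥ (x t).2) := by
    rw [Matrix.mulVec_transpose, dotProduct_comm, ← Matrix.dotProduct_mulVec]
  have e3 := dotProduct_mulVec_comm_of_transpose_eq hKp ((x t).1 - qd) (x t).2
  rw [e1, M_mulVec_closedLoopField, dotProduct_netForce, dotProduct_C₁_mulVec]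
  simp only [closedLoopField, Matrix.add_mulVec, dotProduct_add, e2, e3, Matrix.zero_mulVec,
    dotProduct_zero, power]
  ring

/-- The C₂ part of dM/dt cancels against the force, leaving its transpose in the coupling matrix.
The term -eᵀ Kp e is the decay in position that the energy alone does not provide. -/
theorem hasDerivAlong_crossTerm :
    HasDerivAlong (closedLoopField R Kp Kd qd) (crossTerm R qd) (crossTermDeriv R Kp Kd qd) := by
  intro x s t hx
  have hq := hasDerivWithinAt_fst hx
  have hv := hasDerivWithinAt_snd hx
  refine (hasDerivWithinAt_dotProduct_mulVec (hq.sub_const qd) (hasDerivWithinAt_M R hq)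
    hv).congr_deriv ?_
  rw [M_mulVec_closedLoopField, dotProduct_netForce]
  simp only [closedLoopField, crossTermDeriv, couplingMatrix, Matrix.add_mulVec, dotProduct_add,
    Matrix.sub_mulVec, dotProduct_sub]
  ring

theorem power_nonpos (hKd : Kd.PosDef) (x : Config N × Config N) : power R Kd x ≤ 0 := by
  have h1 : 0 ≤ x.2 ⬝ᵥ (Kd *ᵥ x.2) := by simpa using hKd.posSemidef.dotProduct_mulVec_nonneg x.2
  have h2 := dotProduct_D_mulVec_nonneg R x.1 x.2
  rw [power]
  linarith

theorem M_form_nonneg (q w : Config N) : 0 ≤ w ⬝ᵥ (R.M q *ᵥ w) := by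
  simpa using (posDef_M R q).posSemidef.dotProduct_mulVec_nonneg w

theorem continuous_M_entry (k l : Fin N × Fin 6) :
    Continuous fun x : Config N × Config N => R.M x.1 k l :=
  (locallyLipschitz_M R k l).continuous.comp continuous_fst

theorem continuous_energy : Continuous (energy R Kp qd) := by
  have hM := continuous_M_entry R
  unfold energy
  simp only [Matrix.mulVec, dotProduct, Pi.sub_apply]
  fun_prop

theorem energy_pos (hKp : Kp.PosDef) (x : Config N × Config N) (hx : x ≠ (qd, 0)) :
    0 < energy R Kp qd x := by
  have h1 := M_form_nonneg R x.1 x.2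
  have h2 : 0 ≤ (x.1 - qd) ⬝ᵥ (Kp *ᵥ (x.1 - qd)) := by
    simpa using hKp.posSemidef.dotProduct_mulVec_nonneg (x.1 - qd)
  rw [energy]
  by_cases hq : x.1 = qd
  · have hv : x.2 ≠ 0 := fun hv => hx (Prod.ext hq hv)
    have h3 : 0 < x.2 ⬝ᵥ (R.M x.1 *ᵥ x.2) := by
      simpa using (posDef_M R x.1).dotProduct_mulVec_pos hv
    linarith
  · have h3 : 0 < (x.1 - qd) ⬝ᵥ (Kp *ᵥ (x.1 - qd)) := by
      simpa using hKp.dotProduct_mulVec_pos (sub_ne_zero.2 hq)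
    linarith

theorem exists_pos_forall_mul_dotProduct_le {K : Matrix (Fin N × Fin 6) (Fin N × Fin 6) ℝ}
    (hK : K.PosDef) : ∃ α > 0, ∀ w, α * (w ⬝ᵥ w) ≤ w ⬝ᵥ (K *ᵥ w) := by
  obtain ⟨α, hα, h⟩ := exists_pos_forall_mul_le_dotProduct (P := Unit) isCompact_univ
    (A := fun _ => K) (fun _ _ => continuous_const) fun _ => hK
  exact ⟨α, hα, h () trivial⟩

/-- The spring confines q to a ball. M has a positive lower bound on that compact ball, though
perhaps not globally, and this confines v. -/
theorem isBounded_energy_le (hKp : Kp.PosDef) (c : ℝ) :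
    Bornology.IsBounded {x | energy R Kp qd x ≤ c} := by
  obtain ⟨α, hα, hαle⟩ := exists_pos_forall_mul_dotProduct_le hKp
  obtain ⟨m, hm, hmle⟩ := exists_pos_forall_mul_le_dotProduct
    (isCompact_closedBall qd (√(2 * c / α))) (fun k l => (locallyLipschitz_M R k l).continuous)
    (posDef_M R)
  refine ((Metric.isBounded_closedBall (x := qd) (r := √(2 * c / α))).prod
    (Metric.isBounded_closedBall (x := (0 : Config N)) (r := √(2 * c / m)))).subset fun x hx => ?_
  have hx' : energy R Kp qd x ≤ c := hx
  rw [energy] at hx'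
  have h1 := M_form_nonneg R x.1 x.2
  have h2 := hαle (x.1 - qd)
  have h2' : 0 ≤ (x.1 - qd) ⬝ᵥ (Kp *ᵥ (x.1 - qd)) := by
    simpa using hKp.posSemidef.dotProduct_mulVec_nonneg (x.1 - qd)
  have hq : x.1 ∈ Metric.closedBall qd (√(2 * c / α)) := by
    rw [mem_closedBall_iff_norm]
    refine (norm_le_sqrt_dotProduct _).trans (Real.sqrt_le_sqrt ?_)
    rw [le_div_iff₀ hα]
    linarith
  refine ⟨hq, ?_⟩
  rw [mem_closedBall_zero_iff]
  refine (norm_le_sqrt_dotProduct _).trans (Real.sqrt_le_sqrt ?_)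
  rw [le_div_iff₀ hm]
  linarith [hmle x.1 hq x.2]

theorem continuous_couplingMatrix_entry (k l : Fin N × Fin 6) :
    Continuous fun x : Config N × Config N => couplingMatrix R Kd x k l :=
  ((((locallyLipschitz_C₂ R l k).continuous.sub (locallyLipschitz_C₁ R k l).continuous).sub
    (locallyLipschitz_D R k l).continuous).sub continuous_const)

theorem exists_entrySum_bound (hKp : Kp.PosDef) (c : ℝ) : ∃ β > 0, ∀ x, energy R Kp qd x ≤ c →
    entrySum (R.M x.1) ≤ β ∧ entrySum (couplingMatrix R Kd x) ≤ β ∧ entrySum Kp ≤ β := by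
  have hK : IsCompact {x | energy R Kp qd x ≤ c} :=
    Metric.isCompact_of_isClosed_isBounded (isClosed_le (continuous_energy R Kp qd)
      continuous_const) (isBounded_energy_le R Kp qd hKp c)
  have hM := continuous_M_entry R
  have hB := continuous_couplingMatrix_entry R Kd
  have hM' : Continuous fun x : Config N × Config N => entrySum (R.M x.1) := by
    unfold entrySum; fun_prop
  have hB' : Continuous fun x : Config N × Config N => entrySum (couplingMatrix R Kd x) := by
    unfold entrySum; fun_prop
  obtain ⟨b₁, h₁⟩ := hK.bddAbove_image hM'.continuousOn
  obtain ⟨b₂, h₂⟩ := hK.bddAbove_image hB'.continuousOn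
  -- The entry 1 only serves to make the bound positive.
  refine ⟨max (max b₁ b₂) (max (entrySum Kp) 1), by positivity, fun x hx => ⟨?_, ?_, ?_⟩⟩
  · exact (h₁ (mem_image_of_mem _ hx)).trans ((le_max_left _ _).trans (le_max_left _ _))
  · exact (h₂ (mem_image_of_mem _ hx)).trans ((le_max_right _ _).trans (le_max_left _ _))
  · exact (le_max_left _ _).trans (le_max_right _ _)

/-- The cross term trades a little of the damping in v for decay in e. On the sublevel set all
coefficients are bounded by one β, so a small weight ε makes this trade profitable everywhere. -/
theorem exists_strict_lyapunov (hKp : Kp.PosDef) (hKd : Kd.PosDef) (c : ℝ) :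
    ∃ (W W' : Config N × Config N → ℝ) (κ : ℝ), 0 < κ ∧
      HasDerivAlong (closedLoopField R Kp Kd qd) W W' ∧
      ∀ x, energy R Kp qd x ≤ c → energy R Kp qd x ≤ W x ∧ W' x ≤ -κ * W x := by
  have hKpT : Kpᵀ = Kp := by simpa using hKp.isHermitian.eq
  obtain ⟨α, hα, hαle⟩ := exists_pos_forall_mul_dotProduct_le hKp
  obtain ⟨η, hη, hηle⟩ := exists_pos_forall_mul_dotProduct_le hKd
  obtain ⟨β, hβ, hβle⟩ := exists_entrySum_bound R Kp Kd qd hKp c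
  -- σ bounds the cross term by the energy: |eᵀ M v| ≤ (eᵀ M e + vᵀ M v) / 2, and eᵀ M e ≤ (β / α)
  -- eᵀ Kp e.
  set σ : ℝ := 1 + β / α with hσ
  -- γ is the cost in |v|² of the derivative of the cross term: β from vᵀ M v, the rest from Young's
  -- inequality with half of the decay α |e|² used up.
  set γ : ℝ := β + β ^ 2 / (2 * α) with hγ
  have hσ0 : 0 < σ := by positivity
  have hγ0 : 0 < γ := by positivity
  -- The first bound keeps the perturbed energy between 1/2 and 3/2 of the energy; the second lets
  -- half of the damping pay for γ.
  set ε : ℝ := min (1 / (2 * σ)) (η / (2 * γ)) with hε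
  have hε0 : 0 < ε := by positivity
  have hεσ : ε * σ ≤ 1 / 2 := by
    have := min_le_left (1 / (2 * σ)) (η / (2 * γ))
    rw [← hε, le_div_iff₀ (by positivity)] at this
    linarith
  have hεγ : ε * γ ≤ η / 2 := by
    have := min_le_right (1 / (2 * σ)) (η / (2 * γ))
    rw [← hε, le_div_iff₀ (by positivity)] at this
    linarith
  set μ : ℝ := min η (ε * α) with hμ
  have hμ0 : 0 < μ := by positivity
  -- The factor 2 turns the lower bound by half the energy into domination of the energy. The rate
  -- compares W' ≤ -μ (|e|² + |v|²) with W ≤ (3/2) β (|e|² + |v|²).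
  refine ⟨fun x => 2 * (energy R Kp qd x + ε * crossTerm R qd x),
    fun x => 2 * (power R Kd x + ε * crossTermDeriv R Kp Kd qd x), μ / (3 / 2 * β), by positivity,
    fun x s t hx => ((hasDerivAlong_energy R Kp Kd qd hKpT x s t hx).add
      ((hasDerivAlong_crossTerm R Kp Kd qd x s t hx).const_mul ε)).const_mul 2, fun x hx => ?_⟩
  obtain ⟨hβM, hβB, hβK⟩ := hβle x hx
  set e : Config N := x.1 - qd with he
  set v : Config N := x.2 with hv
  have ha0 : 0 ≤ e ⬝ᵥ e := by simpa using dotProduct_star_self_nonneg e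
  have hb0 : 0 ≤ v ⬝ᵥ v := by simpa using dotProduct_star_self_nonneg v
  have hbound : ∀ {A : Matrix (Fin N × Fin 6) (Fin N × Fin 6) ℝ} (y z : Config N) {δ : ℝ},
      entrySum A ≤ β → 0 < δ → |y ⬝ᵥ (A *ᵥ z)| ≤ β * (δ * (y ⬝ᵥ y) + (z ⬝ᵥ z) / (4 * δ)) := by
    intro A y z δ hA hδ
    refine (abs_dotProduct_mulVec_le A y z hδ).trans (mul_le_mul_of_nonneg_right hA ?_)
    have hy : 0 ≤ y ⬝ᵥ y := by simpa using dotProduct_star_self_nonneg y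
    have hz : 0 ≤ z ⬝ᵥ z := by simpa using dotProduct_star_self_nonneg z
    positivity
  have hself : ∀ {A : Matrix (Fin N × Fin 6) (Fin N × Fin 6) ℝ} (y : Config N),
      entrySum A ≤ β → y ⬝ᵥ (A *ᵥ y) ≤ β * (y ⬝ᵥ y) := by
    intro A y hA
    have := (le_abs_self _).trans (hbound y y hA (show (0 : ℝ) < 1 / 2 by norm_num))
    linarith
  have hvMv := hself v hβM
  have heMe := hself e hβM
  have heKe := hself e hβK
  have hαe := hαle e
  have hηv := hηle v
  have hMv0 := M_form_nonneg R x.1 v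
  have hD := dotProduct_D_mulVec_nonneg R x.1 v
  have hcross : |crossTerm R qd x| ≤ σ * energy R Kp qd x := by
    -- Positivity of M on e - v and e + v bounds eᵀ M v from both sides.
    have h1 := M_form_nonneg R x.1 (e - v)
    have h2 := M_form_nonneg R x.1 (e + v)
    have hsymm := dotProduct_mulVec_comm_of_transpose_eq (transpose_M R x.1) v e
    simp only [Matrix.mulVec_sub, Matrix.mulVec_add, sub_dotProduct, add_dotProduct,
      dotProduct_sub, dotProduct_add, hsymm] at h1 h2
    have h3 : e ⬝ᵥ (R.M x.1 *ᵥ e) ≤ β / α * (e ⬝ᵥ (Kp *ᵥ e)) := by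
      calc e ⬝ᵥ (R.M x.1 *ᵥ e) ≤ β * (e ⬝ᵥ e) := heMe
        _ = β / α * (α * (e ⬝ᵥ e)) := by field_simp
        _ ≤ _ := by gcongr
    have h4 : 0 ≤ β / α * (v ⬝ᵥ (R.M x.1 *ᵥ v)) := by positivity
    have h5 : 0 ≤ e ⬝ᵥ (Kp *ᵥ e) := (mul_nonneg hα.le ha0).trans hαe
    rw [crossTerm, energy, ← he, ← hv, abs_le, hσ]
    constructor <;> nlinarith
  have hen : energy R Kp qd x ≤ β / 2 * (e ⬝ᵥ e + v ⬝ᵥ v) := by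
    rw [energy, ← he, ← hv]
    linarith
  have hen0 : 0 ≤ energy R Kp qd x := by
    have h5 : 0 ≤ e ⬝ᵥ (Kp *ᵥ e) := (mul_nonneg hα.le ha0).trans hαe
    rw [energy, ← he, ← hv]
    positivity
  have hεcross : |ε * crossTerm R qd x| ≤ 1 / 2 * energy R Kp qd x := by
    rw [abs_mul, abs_of_pos hε0]
    calc ε * |crossTerm R qd x| ≤ ε * (σ * energy R Kp qd x) := by gcongr
      _ = ε * σ * energy R Kp qd x := by ring
      _ ≤ _ := by gcongr
  obtain ⟨hlow, hup⟩ := abs_le.1 hεcross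
  have hderiv : crossTermDeriv R Kp Kd qd x ≤ -(α / 2) * (e ⬝ᵥ e) + γ * (v ⬝ᵥ v) := by
    -- This δ makes the |e|² coefficient exactly α / 2, half of what Kp supplies.
    have h1 := (le_abs_self _).trans (hbound e v hβB (show 0 < α / (2 * β) by positivity))
    have h2 : β * (α / (2 * β) * (e ⬝ᵥ e) + (v ⬝ᵥ v) / (4 * (α / (2 * β)))) =
        α / 2 * (e ⬝ᵥ e) + β ^ 2 / (2 * α) * (v ⬝ᵥ v) := by
      field_simp
      ring
    rw [crossTermDeriv, ← he, ← hv, hγ]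
    linarith
  refine ⟨by linarith, ?_⟩
  have hW' : 2 * (power R Kd x + ε * crossTermDeriv R Kp Kd qd x) ≤ -μ * (e ⬝ᵥ e + v ⬝ᵥ v) := by
    have h1 : ε * crossTermDeriv R Kp Kd qd x ≤
        -(ε * α / 2) * (e ⬝ᵥ e) + ε * γ * (v ⬝ᵥ v) := by
      calc _ ≤ ε * (-(α / 2) * (e ⬝ᵥ e) + γ * (v ⬝ᵥ v)) := by gcongr
        _ = _ := by ring
    have h2 : ε * γ * (v ⬝ᵥ v) ≤ η / 2 * (v ⬝ᵥ v) := by gcongr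
    have h3 : μ * (e ⬝ᵥ e) ≤ ε * α * (e ⬝ᵥ e) := by gcongr; exact min_le_right _ _
    have h4 : μ * (v ⬝ᵥ v) ≤ η * (v ⬝ᵥ v) := by gcongr; exact min_le_left _ _
    rw [power, ← hv]
    linarith
  have hfin : μ / (3 / 2 * β) * (2 * (energy R Kp qd x + ε * crossTerm R qd x)) ≤
      μ * (e ⬝ᵥ e + v ⬝ᵥ v) := by
    calc _ ≤ μ / (3 / 2 * β) * (3 / 2 * β * (e ⬝ᵥ e + v ⬝ᵥ v)) := by
          refine mul_le_mul_of_nonneg_left ?_ (by positivity)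
          linarith
      _ = _ := by field_simp
  linarith

end ClosedLoop

end PCS

end

theorem mainTheorem3 {N : ℕ} (R : PCS.Robot N)
    (hcable : R.cable = none)
    (hgrav : ∀ q : PCS.Config N, R.gravForce q = 0)
    (Kp Kd : Matrix (Fin N × Fin 6) (Fin N × Fin 6) ℝ)
    (hKp : Kp.PosDef) (hKd : Kd.PosDef) (qd : PCS.Config N) :
    (∀ q : PCS.Config N, R.F q = 0) ∧
      PCS.IsGAS (R.ClosedLoop (PCS.pdLaw Kp Kd qd)) (qd, 0) :=
  ⟨PCS.F_eq_zero hcable,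
    PCS.isGAS_of_lyapunov (PCS.closedLoop_iff Kp Kd qd hcable hgrav)
      (PCS.locallyLipschitz_closedLoopField R Kp Kd qd)
      (by simp [PCS.closedLoopField, PCS.netForce, PCS.pdLaw])
      (PCS.continuous_energy R Kp qd) (by simp [PCS.energy]) (PCS.energy_pos R Kp qd hKp)
      (PCS.isBounded_energy_le R Kp qd hKp)
      (PCS.hasDerivAlong_energy R Kp Kd qd (by simpa using hKp.isHermitian.eq))
      (PCS.power_nonpos R Kd hKd) (PCS.exists_strict_lyapunov R Kp Kd qd hKp hKd)⟩
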